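/- **Definitions.** Let $A=\{z\in\mathbb C: 1\le |z|\le 2\}$. Consider a finite directed graph $\Gamma$ (multiple edges and loop edges are allowed, as are *free loops*, i.e. directed closed curves without vertices) topologically embedded in the interior of $A$. A vertex is a *split* if it has exactly one incoming and two outgoing edges, and a *merge* if it has exactly two incoming edges and one outgoing edge. A *directed cycle* is either a free loop or a nonempty closed directed walk, up to cyclic rotation, that is not a proper power of a shorter closed walk. $\Gamma$ is an *annular strand diagram* if every vertex is a merge or a split and every directed cycle has positive (counterclockwise) winding number around the central hole. It is *reduced* if it contains none of the following: an edge from a merge to a split; two edges from a split to a merge which together bound a disc in $A$; two concentric free loops with no part of the diagram between them. A *component* is a connected component of the graph (each free loop is one). A *cutting path* is a continuous path in $A$ from the inner circle to the outer circle that passes through no vertex and meets the edges and free loops transversely, these always crossing the path from right to left (at each intersection the path and the edge are differentiable with velocities $u,v$ such that $\operatorname{Im}(\bar u v)>0$). A directed cycle is a *split loop* (*merge loop*) if it has vertices and all of them are splits (merges). **Proposition.** For any reduced annular strand diagram: 1. Any two distinct directed cycles are disjoint, and no directed cycle intersects itself. 2. Every directed cycle winds exactly once around the central hole, and any cutting path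 meets each directed cycle exactly once. 3. Every component contains at least one directed cycle. 4. Any component with only one directed cycle is a free loop. 5. The directed cycles of each component can be listed as $C_1,\dots,C_n$, without repetition, such that they are concentric from the inside outwards (for $i<j$ the cycle $C_j$ winds once around every point of $C_i$), every cutting path meets them in the order $C_1,\dots,C_n$ (so that the order is independent of the cutting path), and for each $i<n$ one of $C_i,C_{i+1}$ is a merge loop and the other is a split loop. -/

import Mathlib

open Set

/-- The curve `γ`, restricted to `[0,1]`, misses the point `p`, and the total (signed) change of the
argument of `γ t - p` along it is `θ`; `φ` is a continuous choice of the argument. -/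
def HasAngleChange (γ : ℝ → ℂ) (p : ℂ) (θ : ℝ) : Prop :=
  (∀ t ∈ Icc (0 : ℝ) 1, γ t ≠ p) ∧
  ∃ φ : ℝ → ℝ, ContinuousOn φ (Icc 0 1) ∧
    (∀ t ∈ Icc (0 : ℝ) 1, γ t - p = (‖γ t - p‖ : ℂ) * Complex.exp ((φ t : ℂ) * Complex.I)) ∧
    φ 1 - φ 0 = θ

/-- A directed graph (multiple edges, loop edges and free loops are allowed) topologically embedded
in the interior `1 < ‖z‖ < 2` of the annulus `1 ≤ ‖z‖ ≤ 2`. The types `V`, `E`, `L` index the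
vertices, the edges and the free loops. Only the restriction of `edge e` to `[0,1]` matters. -/
structure AnnularGraph (V E L : Type*) where
  src : E → V
  tgt : E → V
  pos : V → ℂ
  edge : E → ℝ → ℂ
  loop : L → ℝ → ℂ
  pos_injective : Function.Injective pos
  edge_continuousOn : ∀ e, ContinuousOn (edge e) (Icc 0 1)
  edge_zero : ∀ e, edge e 0 = pos (src e)
  edge_one : ∀ e, edge e 1 = pos (tgt e)
  edge_inj : ∀ e f, ∀ s ∈ Ioo (0 : ℝ) 1, ∀ t ∈ Ioo (0 : ℝ) 1, edge e s = edge f t → e = f ∧ s = t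
  edge_ne_pos : ∀ e v, ∀ s ∈ Ioo (0 : ℝ) 1, edge e s ≠ pos v
  loop_continuous : ∀ l, Continuous (loop l)
  loop_periodic : ∀ l, Function.Periodic (loop l) 1
  loop_inj : ∀ l m, ∀ s ∈ Ico (0 : ℝ) 1, ∀ t ∈ Ico (0 : ℝ) 1, loop l s = loop m t → l = m ∧ s = t
  loop_ne_pos : ∀ l v s, loop l s ≠ pos v
  loop_ne_edge : ∀ l e s, ∀ t ∈ Icc (0 : ℝ) 1, loop l s ≠ edge e t
  pos_mem : ∀ v, 1 < ‖pos v‖ ∧ ‖pos v‖ < 2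
  edge_mem : ∀ e, ∀ s ∈ Icc (0 : ℝ) 1, 1 < ‖edge e s‖ ∧ ‖edge e s‖ < 2
  loop_mem : ∀ l s, 1 < ‖loop l s‖ ∧ ‖loop l s‖ < 2

namespace AnnularGraph

variable {V E L : Type*} (G : AnnularGraph V E L)

/-- A split has exactly one incoming edge and exactly two outgoing edges. -/
def IsSplit (v : V) : Prop :=
  (∃! e, G.tgt e = v) ∧ {e | G.src e = v}.ncard = 2

/-- A merge has exactly two incoming edges and exactly one outgoing edge. -/
def IsMerge (v : V) : Prop :=
  {e | G.tgt e = v}.ncard = 2 ∧ ∃! e, G.src e = v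

/-- The set of all points of the drawn graph. -/
def support : Set ℂ :=
  range G.pos ∪ (⋃ e, G.edge e '' Icc 0 1) ∪ ⋃ l, range (G.loop l)

/-- A directed cycle: either a free loop, or a nonempty closed directed walk, taken up to cyclic
rotation, that is not a proper power of a shorter closed walk. A walk may a priori visit vertices
and edges several times. -/
inductive DirectedCycle : Type _
  | walk (c : Cycle E) (ne_nil : c ≠ Cycle.nil)
      (chain : c.Chain fun e f => G.tgt e = G.src f)
      (primitive : ∀ (m : List E) (k : ℕ),
        c = (((List.replicate k m).flatten : List E) : Cycle E) → k = 1) : DirectedCycle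
  | free (l : L) : DirectedCycle

/-- Connected components of the underlying undirected graph; each free loop is one. -/
abbrev Component : Type _ :=
  Quot (fun u v : V => ∃ e, G.src e = u ∧ G.tgt e = v) ⊕ L

namespace DirectedCycle

variable {G}

/-- The set of points of the annulus on the cycle. -/
def trace : G.DirectedCycle → Set ℂ
  | walk c _ _ _ => ⋃ e ∈ c, G.edge e '' Icc 0 1
  | free l => range (G.loop l)

/-- The cycle winds exactly `w` times around the point `p`, which does not lie on it. -/
def HasWinding (p : ℂ) (w : ℤ) : G.DirectedCycle → Prop
  | walk c _ _ _ => ∃ θ : E → ℝ, (∀ e ∈ c, HasAngleChange (G.edge e) p (θ e)) ∧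
      (c.toMultiset.map θ).sum = 2 * Real.pi * w
  | free l => HasAngleChange (G.loop l) p (2 * Real.pi * w)

/-- The cycle does not intersect itself: it visits no vertex twice. (Free loops are simple closed
curves by the definition of an embedded graph.) -/
def IsSimple : G.DirectedCycle → Prop
  | walk c _ _ _ => (c.map G.src).Nodup
  | free _ => True

/-- The cycle is contained in the given component. -/
def LiesIn (K : G.Component) : G.DirectedCycle → Prop
  | walk c _ _ _ => ∀ e ∈ c, Sum.inl (Quot.mk _ (G.src e)) = K
  | free l => Sum.inr l = K

/-- A cycle with vertices, all of which are splits. -/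
def IsSplitLoop : G.DirectedCycle → Prop
  | walk c _ _ _ => ∀ e ∈ c, G.IsSplit (G.src e)
  | free _ => False

/-- A cycle with vertices, all of which are merges. -/
def IsMergeLoop : G.DirectedCycle → Prop
  | walk c _ _ _ => ∀ e ∈ c, G.IsMerge (G.src e)
  | free _ => False

/-- `a` lies strictly inside `b`: the cycle `b` winds once around every point of `a`. -/
def Inside (a b : G.DirectedCycle) : Prop :=
  ∀ p ∈ a.trace, b.HasWinding p 1

end DirectedCycle

/-- An annular strand diagram: every vertex is a merge or a split, and every directed cycle has
positive (that is, counterclockwise) winding number around the central hole. -/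
structure IsAnnularStrandDiagram : Prop where
  split_or_merge : ∀ v, G.IsSplit v ∨ G.IsMerge v
  winding_pos : ∀ c : G.DirectedCycle, ∃ w : ℤ, 0 < w ∧ c.HasWinding 0 w

/-- A merge directly followed by a split: such a configuration reduces to two parallel strands. -/
def HasMergeSplit : Prop :=
  ∃ e, G.IsMerge (G.src e) ∧ G.IsSplit (G.tgt e)

/-- A split whose two outgoing edges `e`, `f` run to the same merge and span a disc of the annulus,
that is, the simple closed curve formed by `e` and the reverse of `f` has winding number zero around
the hole: such a configuration reduces to a single strand. -/
def HasBigon : Prop :=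
  ∃ e f, e ≠ f ∧ G.src e = G.src f ∧ G.tgt e = G.tgt f ∧ G.IsSplit (G.src e) ∧
    G.IsMerge (G.tgt e) ∧
    ∃ θ : ℝ, HasAngleChange (G.edge e) 0 θ ∧ HasAngleChange (G.edge f) 0 θ

/-- Two concentric free loops with nothing in between (every other point of the graph is encircled
by both or by neither of them): such loops reduce to a single one. -/
def HasAdjacentFreeLoops : Prop :=
  ∃ l m, l ≠ m ∧ ∀ p ∈ G.support, p ∉ range (G.loop l) → p ∉ range (G.loop m) →
    ∃ w : ℤ, (DirectedCycle.free l : G.DirectedCycle).HasWinding p w ∧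
      (DirectedCycle.free m : G.DirectedCycle).HasWinding p w

/-- A graph is reduced if none of the three reductions applies. -/
def IsReduced : Prop :=
  ¬ G.HasMergeSplit ∧ ¬ G.HasBigon ∧ ¬ G.HasAdjacentFreeLoops

/-- The path `σ` at time `t` and the curve `γ` at time `s` have velocities `u`, `v` such that
`(u, v)` is a positively oriented basis of the plane: `γ` crosses `σ` from right to left. -/
def PositiveCrossing (σ : ℝ → ℂ) (t : ℝ) (γ : ℝ → ℂ) (s : ℝ) : Prop :=
  ∃ u v : ℂ, HasDerivAt σ u t ∧ HasDerivAt γ v s ∧ 0 < (starRingEnd ℂ u * v).im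

/-- A cutting path, parametrized by `[0,1]`: a path in the annulus from the inner to the outer circle
that avoids the vertices and meets the edges and free loops transversely, these always crossing it
from right to left (so that they pass it counterclockwise around the hole). -/
structure IsCuttingPath (σ : ℝ → ℂ) : Prop where
  continuousOn : ContinuousOn σ (Icc 0 1)
  mem_annulus : ∀ t ∈ Icc (0 : ℝ) 1, 1 ≤ ‖σ t‖ ∧ ‖σ t‖ ≤ 2
  start : ‖σ 0‖ = 1
  finish : ‖σ 1‖ = 2
  ne_pos : ∀ t ∈ Icc (0 : ℝ) 1, ∀ v, σ t ≠ G.pos v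
  cross_edge : ∀ t ∈ Icc (0 : ℝ) 1, ∀ e, ∀ s ∈ Ioo (0 : ℝ) 1, σ t = G.edge e s →
    PositiveCrossing σ t (G.edge e) s
  cross_loop : ∀ t ∈ Icc (0 : ℝ) 1, ∀ l s, σ t = G.loop l s → PositiveCrossing σ t (G.loop l) s

end AnnularGraph

/-! Reducedness forbids an edge from a merge to a split, so everything downstream of a merge is a
merge and everything upstream of a split is a split. Going once around a directed cycle with
vertices, its vertices are therefore all merges or all splits. On a merge loop the next edge is
forced, on a split loop the previous one is. With primitivity, such a cycle is exactly one periodic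
orbit of a successor or predecessor function, determined by any one of its edges. Hence cycles are
simple, and cycles that share a vertex coincide (`isSimple`, `eq_of_src_eq`, `disjoint_trace`).

A simple cycle is then a simple closed curve (`exists_parametrizes`), and plane topology takes over.
Its winding number around the hole is positive by hypothesis and at most 1 because the curve is
simple (`le_one_of_injective`, an argument in the spirit of Hopf's Umlaufsatz). Along a cutting path
the winding number of the cycle around the moving point starts at 1, ends at 0, and drops by exactly
one at each crossing (`exists_of_crossing`), so there is exactly one crossing. Of two disjoint
curves winding once around the origin, the one reaching further out encloses the other
(`of_forall_exists_norm_le`). The maximal modulus `radius` thus orders the cycles by nesting, and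
cutting paths meet them in that order.

Every component contains a cycle, found by following edges in a finite graph. A component with
vertices contains merges and splits, by counting edge ends; going forward from a merge gives a merge
loop and backward from a split gives a split loop, hence two distinct cycles (`exists_ne_liesIn`).
If two neighbouring cycles of a component were both merge loops, the vertices between them would be
nonempty by connectedness and closed under going backward, since a merge loop cannot be left in the
forward direction. They would contain a third cycle in between. Split loops are treated dually
(`between_closed`, `not_both_isMergeLoop_or_isSplitLoop`). -/

/-! ### Continuous arguments of nonvanishing functions. -/

/-- `φ` is a continuous choice of the argument of the nonvanishing function `f` on `s`. -/
def IsAngleOn {X : Type*} [TopologicalSpace X] (φ : X → ℝ) (f : X → ℂ) (s : Set X) : Prop :=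
  ContinuousOn φ s ∧ ∀ x ∈ s, f x ≠ 0 ∧ f x = (‖f x‖ : ℂ) * Complex.exp ((φ x : ℂ) * Complex.I)

/-- A continuous function on a preconnected set with values in `2πℤ` is constant. -/
theorem eq_of_continuousOn_of_forall_two_pi {X : Type*} [TopologicalSpace X] {s : Set X}
    (hs : IsPreconnected s) {g : X → ℝ} (hg : ContinuousOn g s)
    (h : ∀ x ∈ s, ∃ n : ℤ, g x = 2 * Real.pi * n) {x y : X} (hx : x ∈ s) (hy : y ∈ s) :
    g x = g y := by
  have key : ∀ x ∈ s, ∀ y ∈ s, ¬ g x < g y := by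
    intro x hx y hy hlt
    obtain ⟨m, hm⟩ := h x hx
    obtain ⟨n, hn⟩ := h y hy
    have hpi := Real.pi_pos
    have hmn : m < n := by
      have : (m : ℝ) < n := by
        rw [hm, hn] at hlt
        exact lt_of_mul_lt_mul_left hlt (by positivity)
      exact_mod_cast this
    have hmn' : (m : ℝ) + 1 ≤ n := by exact_mod_cast hmn
    -- An odd multiple of `π` lies between two different multiples of `2π`; attaining it contradicts
    -- parity.
    have hmid : Real.pi * (2 * m + 1) ∈ Icc (g x) (g y) := by
      rw [hm, hn]
      constructor <;> nlinarith
    obtain ⟨z, hz, hgz⟩ := hs.intermediate_value hx hy hg hmid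
    obtain ⟨k, hk⟩ := h z hz
    rw [hk] at hgz
    have h2 : (2 * k : ℝ) = 2 * m + 1 := by
      apply mul_left_cancel₀ hpi.ne'
      linarith
    have h3 : 2 * k = 2 * m + 1 := by exact_mod_cast h2
    omega
  exact le_antisymm (not_lt.1 (key y hy x hx)) (not_lt.1 (key x hx y hy))

theorem exists_int_of_polar_eq {z : ℂ} (hz : z ≠ 0) {a b : ℝ}
    (ha : z = (‖z‖ : ℂ) * Complex.exp ((a : ℂ) * Complex.I))
    (hb : z = (‖z‖ : ℂ) * Complex.exp ((b : ℂ) * Complex.I)) :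
    ∃ n : ℤ, a - b = 2 * Real.pi * n := by
  have h0 : (‖z‖ : ℂ) ≠ 0 := by simpa using hz
  have h1 := mul_left_cancel₀ h0 (ha.symm.trans hb)
  obtain ⟨n, hn⟩ := Complex.exp_eq_exp_iff_exists_int.1 h1
  refine ⟨n, ?_⟩
  have h2 : (a : ℂ) = b + n * (2 * Real.pi) := by
    apply mul_right_cancel₀ Complex.I_ne_zero
    linear_combination hn
  have h3 : a = b + n * (2 * Real.pi) := by exact_mod_cast h2
  linarith

namespace IsAngleOn

variable {X Y : Type*} [TopologicalSpace X] [TopologicalSpace Y] {φ ψ : X → ℝ} {f g : X → ℂ}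
  {s t : Set X}

theorem mono (h : IsAngleOn φ f s) (hts : t ⊆ s) : IsAngleOn φ f t :=
  ⟨h.1.mono hts, fun x hx => h.2 x (hts hx)⟩

theorem congr (h : IsAngleOn φ f s) (hfg : EqOn f g s) : IsAngleOn φ g s :=
  ⟨h.1, fun x hx => by rw [← hfg hx]; exact h.2 x hx⟩

theorem comp (h : IsAngleOn φ f s) {u : Y → X} {r : Set Y} (hu : ContinuousOn u r)
    (hr : MapsTo u r s) : IsAngleOn (φ ∘ u) (f ∘ u) r :=
  ⟨h.1.comp hu hr, fun _ hx => h.2 _ (hr hx)⟩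

theorem mul (hf : IsAngleOn φ f s) (hg : IsAngleOn ψ g s) :
    IsAngleOn (fun x => φ x + ψ x) (fun x => f x * g x) s := by
  refine ⟨hf.1.add hg.1, fun x hx => ⟨mul_ne_zero (hf.2 x hx).1 (hg.2 x hx).1, ?_⟩⟩
  rw [norm_mul]
  push_cast
  rw [add_mul, Complex.exp_add]
  conv_lhs => rw [(hf.2 x hx).2, (hg.2 x hx).2]
  ring

theorem const {z : ℂ} (hz : z ≠ 0) : IsAngleOn (fun _ => z.arg) (fun _ : X => z) s :=
  ⟨continuousOn_const, fun _ _ => ⟨hz, (Complex.norm_mul_exp_arg_mul_I z).symm⟩⟩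

theorem arg (hf : ContinuousOn f s) (h : ∀ x ∈ s, f x ∈ Complex.slitPlane) :
    IsAngleOn (fun x => (f x).arg) f s :=
  ⟨fun x hx => (Complex.continuousAt_arg (h x hx)).comp_continuousWithinAt (hf x hx),
    fun x hx => ⟨Complex.slitPlane_ne_zero (h x hx), (Complex.norm_mul_exp_arg_mul_I _).symm⟩⟩



theorem sub_eq_sub (hs : IsPreconnected s) (hφ : IsAngleOn φ f s) (hψ : IsAngleOn ψ f s)
    {x y : X} (hx : x ∈ s) (hy : y ∈ s) : φ x - φ y = ψ x - ψ y := by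
  have := eq_of_continuousOn_of_forall_two_pi hs (hφ.1.sub hψ.1)
    (fun z hz => exists_int_of_polar_eq (hφ.2 z hz).1 (hφ.2 z hz).2 (hψ.2 z hz).2) hx hy
  simp only [Pi.sub_apply] at this
  linarith

/-- If the angle runs through the right half plane from the positive to the negative imaginary
axis, it decreases by `π`. -/
theorem eq_sub_pi (hs : IsPreconnected s) (hφ : ContinuousOn φ s)
    (hcos : ∀ z ∈ s, 0 ≤ Real.cos (φ z)) {x y : X} (hx : x ∈ s) (hy : y ∈ s)
    (hsx : Real.sin (φ x) = 1) (hsy : Real.sin (φ y) = -1) : φ y = φ x - Real.pi := by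
  have hpi := Real.pi_pos
  obtain ⟨m, hm⟩ := (Real.sin_eq_one_iff).1 hsx
  obtain ⟨n, hn⟩ := (Real.sin_eq_neg_one_iff).1 hsy
  have key : ∀ (c : ℝ), Real.cos c < 0 → ¬ (φ x ≤ c ∧ c ≤ φ y) ∧ ¬ (φ y ≤ c ∧ c ≤ φ x) := by
    intro c hc
    constructor
    · intro h
      obtain ⟨z, hz, hzc⟩ := hs.intermediate_value hx hy hφ h
      have := hcos z hz
      rw [hzc] at this
      linarith
    · intro h
      obtain ⟨z, hz, hzc⟩ := hs.intermediate_value hy hx hφ h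
      have := hcos z hz
      rw [hzc] at this
      linarith
  -- `φ x` lies between two consecutive odd multiples of `π`, where the cosine is -1. Neither can be
  -- passed, which leaves only `n = m`.
  have h1 := (key (Real.pi + m * (2 * Real.pi)) (by rw [Real.cos_add_int_mul_two_pi]; simp)).1
  have h2 := (key (Real.pi + (m - 1 : ℤ) * (2 * Real.pi))
    (by rw [Real.cos_add_int_mul_two_pi]; simp)).2
  have hnm : n = m := by
    rcases lt_trichotomy n m with h | h | h
    · have h' : (n : ℝ) + 1 ≤ m := by exact_mod_cast h
      exfalso
      apply h2
      push_cast
      constructor <;> nlinarith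
    · exact h
    · have h' : (m : ℝ) + 1 ≤ n := by exact_mod_cast h
      exfalso
      apply h1
      constructor <;> nlinarith
  subst hnm
  linarith

theorem eq_add_pi (hs : IsPreconnected s) (hφ : ContinuousOn φ s)
    (hcos : ∀ z ∈ s, Real.cos (φ z) ≤ 0) {x y : X} (hx : x ∈ s) (hy : y ∈ s)
    (hsx : Real.sin (φ x) = 1) (hsy : Real.sin (φ y) = -1) : φ y = φ x + Real.pi := by
  have := eq_sub_pi (φ := fun z => Real.pi - φ z) hs (continuousOn_const.sub hφ)
    (fun z hz => by rw [Real.cos_pi_sub]; linarith [hcos z hz]) hx hy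
    (by rw [Real.sin_pi_sub]; exact hsx) (by rw [Real.sin_pi_sub]; exact hsy)
  linarith

end IsAngleOn

/-- The argument is the imaginary part of a continuous logarithm, which exists over a simply
connected space. -/
theorem exists_isAngleOn_univ {X : Type*} [TopologicalSpace X] [LocallyPathConnectedSpace X]
    (hX : IsSimplyConnected (univ : Set X)) {f : X → ℂ} (hf : Continuous f) (h0 : ∀ x, f x ≠ 0) :
    ∃ φ : X → ℝ, IsAngleOn φ f univ := by
  obtain ⟨g, hg, hgf⟩ := Complex.exists_continuousOn_eqOn_exp_comp hX isOpen_univ hf.continuousOn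
    (by rintro ⟨x, -, hx⟩; exact h0 x hx)
  refine ⟨fun x => (g x).im, Complex.continuous_im.comp_continuousOn hg, fun x _ => ⟨h0 x, ?_⟩⟩
  have hx' : Complex.exp (g x) = f x := hgf (mem_univ x)
  rw [← hx', Complex.norm_exp, Complex.ofReal_exp, ← Complex.exp_add, Complex.re_add_im]

theorem isSimplyConnected_univ_of_real_module {X : Type*} [TopologicalSpace X] [AddCommGroup X]
    [Module ℝ X] [ContinuousAdd X] [ContinuousSMul ℝ X] : IsSimplyConnected (univ : Set X) := by
  have : ContractibleSpace (univ : Set X) := (convex_univ (𝕜 := ℝ)).contractibleSpace univ_nonempty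
  exact (inferInstance : SimplyConnectedSpace (univ : Set X))

theorem exists_isAngleOn_real {f : ℝ → ℂ} (hf : Continuous f) (h0 : ∀ x, f x ≠ 0) :
    ∃ φ : ℝ → ℝ, IsAngleOn φ f univ :=
  exists_isAngleOn_univ isSimplyConnected_univ_of_real_module hf h0

theorem exists_isAngleOn_real_prod {f : ℝ × ℝ → ℂ} (hf : Continuous f) (h0 : ∀ x, f x ≠ 0) :
    ∃ φ : ℝ × ℝ → ℝ, IsAngleOn φ f univ :=
  exists_isAngleOn_univ isSimplyConnected_univ_of_real_module hf h0

/-! ### Winding numbers of closed curves. -/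

/-- The closed curve `γ` of period `N` winds `w` times around the point `p`, which it misses. -/
def WindsAround (γ : ℝ → ℂ) (N : ℝ) (p : ℂ) (w : ℤ) : Prop :=
  ∃ φ : ℝ → ℝ, IsAngleOn φ (fun t => γ t - p) univ ∧ φ N - φ 0 = 2 * Real.pi * w

namespace WindsAround

variable {γ : ℝ → ℂ} {N : ℝ} {p q : ℂ} {w w' : ℤ}

theorem ne (h : WindsAround γ N p w) (t : ℝ) : γ t ≠ p := by
  obtain ⟨φ, hφ, -⟩ := h
  exact sub_ne_zero.1 (hφ.2 t (mem_univ t)).1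

theorem unique (h : WindsAround γ N p w) (h' : WindsAround γ N p w') : w = w' := by
  obtain ⟨φ, hφ, hw⟩ := h
  obtain ⟨ψ, hψ, hw'⟩ := h'
  have h1 := IsAngleOn.sub_eq_sub isPreconnected_univ hφ hψ (mem_univ N) (mem_univ 0)
  rw [hw, hw'] at h1
  have h2 : (w : ℝ) = w' := mul_left_cancel₀ (by positivity) h1
  exact_mod_cast h2

theorem _root_.IsAngleOn.add_period {φ : ℝ → ℝ} (hγ : Function.Periodic γ N)
    (hφ : IsAngleOn φ (fun t => γ t - p) univ) (s t : ℝ) :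
    φ (s + N) - φ s = φ (t + N) - φ t := by
  have h1 : IsAngleOn (φ ∘ fun t => t + N) (fun t => γ t - p) univ :=
    (hφ.comp (u := fun t => t + N) (by fun_prop) (mapsTo_univ _ _)).congr
      (fun t _ => by simp [hγ t])
  have := IsAngleOn.sub_eq_sub isPreconnected_univ h1 hφ (mem_univ s) (mem_univ t)
  simp only [Function.comp] at this
  linarith

theorem _root_.IsAngleOn.exists_winding {φ : ℝ → ℝ} (hγ : γ N = γ 0)
    (hφ : IsAngleOn φ (fun t => γ t - p) univ) : ∃ w : ℤ, φ N - φ 0 = 2 * Real.pi * w := by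
  have h1 := hφ.2 N (mem_univ _)
  have h0 := hφ.2 0 (mem_univ _)
  simp only [hγ] at h1
  exact exists_int_of_polar_eq h1.1 h1.2 h0.2

theorem exists_of_forall_ne (hc : Continuous γ) (hγ : Function.Periodic γ N)
    (hp : ∀ t, γ t ≠ p) : ∃ w, WindsAround γ N p w := by
  obtain ⟨φ, hφ⟩ := exists_isAngleOn_real (hc.sub continuous_const)
    (fun t => sub_ne_zero.2 (hp t))
  obtain ⟨w, hw⟩ := hφ.exists_winding (by simpa using hγ 0)
  exact ⟨w, φ, hφ, hw⟩

/-- Adding the principal argument of the quotient turns an argument of `γ - p` into one of `γ - q`.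
On the slit plane that correction is continuous, and it has equal values at both ends of a period.
-/
theorem of_div_mem_slitPlane (hc : Continuous γ) (hγ : Function.Periodic γ N)
    (h : WindsAround γ N p w) (hq : ∀ t, (γ t - q) / (γ t - p) ∈ Complex.slitPlane) :
    WindsAround γ N q w := by
  have hne := h.ne
  obtain ⟨φ, hφ, hw⟩ := h
  have hcont : ContinuousOn (fun t => (γ t - q) / (γ t - p)) univ :=
    ((hc.sub continuous_const).div (hc.sub continuous_const)
      (fun t => sub_ne_zero.2 (hne t))).continuousOn
  refine ⟨_, (hφ.mul (IsAngleOn.arg hcont (fun t _ => hq t))).congr (fun t _ => ?_), ?_⟩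
  · exact mul_div_cancel₀ _ (sub_ne_zero.2 (hne t))
  · have h0 : γ N = γ 0 := by simpa using hγ 0
    simp only [h0]
    linarith

/-- A point at least as far out as the whole curve is not encircled: `(γ - p) / (-p) = 1 - γ / p`
stays in the open right half plane. -/
theorem zero_of_norm_le (hc : Continuous γ) (hγ : Function.Periodic γ N)
    (hle : ∀ t, ‖γ t‖ ≤ ‖p‖) (hp : ∀ t, γ t ≠ p) : WindsAround γ N p 0 := by
  have hp0 : p ≠ 0 := by
    rintro rfl
    exact hp 0 (by simpa using hle 0)
  have hslit : ∀ t, (γ t - p) / (-p) ∈ Complex.slitPlane := by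
    intro t
    left
    have h1 : (γ t - p) / (-p) = 1 - γ t / p := by field_simp; ring
    have hn : ‖γ t / p‖ ≤ 1 := by
      rw [norm_div]
      exact div_le_one_of_le₀ (hle t) (norm_nonneg _)
    rw [h1, Complex.sub_re, Complex.one_re, sub_pos]
    refine lt_of_le_of_ne ((Complex.re_le_norm _).trans hn) fun h => hp t ?_
    have him : (γ t / p).im = 0 := by
      have h2 := Complex.sq_norm (γ t / p)
      rw [Complex.normSq_apply, h] at h2
      have h3 : ‖γ t / p‖ ^ 2 ≤ 1 := pow_le_one₀ (norm_nonneg _) hn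
      nlinarith [sq_nonneg (γ t / p).im]
    have : γ t / p = 1 := Complex.ext h him
    exact (div_eq_one_iff_eq hp0).1 this
  have hcont : ContinuousOn (fun t => (γ t - p) / (-p)) univ :=
    ((hc.sub continuous_const).div_const _).continuousOn
  refine ⟨_, ((IsAngleOn.const (neg_ne_zero.2 hp0)).mul
    (IsAngleOn.arg hcont (fun t _ => hslit t))).congr (fun t _ => ?_), ?_⟩
  · exact mul_div_cancel₀ _ (neg_ne_zero.2 hp0)
  · have h0 : γ N = γ 0 := by simpa using hγ 0
    simp [h0]

/-- Counterpart for a point no further out than the curve: `(γ - p) / γ = 1 - p / γ` stays in the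
open right half plane, so `p` may replace the origin. -/
theorem of_norm_le (hc : Continuous γ) (hγ : Function.Periodic γ N)
    (h : WindsAround γ N 0 w) (hle : ∀ t, ‖p‖ ≤ ‖γ t‖) (hp : ∀ t, γ t ≠ p) :
    WindsAround γ N p w := by
  refine of_div_mem_slitPlane hc hγ h fun t => ?_
  have hne := h.ne t
  left
  have h1 : (γ t - p) / (γ t - 0) = 1 - p / γ t := by field_simp; ring
  have hn : ‖p / γ t‖ ≤ 1 := by
    rw [norm_div]
    exact div_le_one_of_le₀ (hle t) (norm_nonneg _)
  rw [h1, Complex.sub_re, Complex.one_re, sub_pos]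
  refine lt_of_le_of_ne ((Complex.re_le_norm _).trans hn) fun h => hp t ?_
  have him : (p / γ t).im = 0 := by
    have h2 := Complex.sq_norm (p / γ t)
    rw [Complex.normSq_apply, h] at h2
    have h3 : ‖p / γ t‖ ^ 2 ≤ 1 := pow_le_one₀ (norm_nonneg _) hn
    nlinarith [sq_nonneg (p / γ t).im]
  have : p / γ t = 1 := Complex.ext h him
  exact ((div_eq_one_iff_eq hne).1 this).symm

theorem _root_.isCompact_range_of_periodic (hc : Continuous γ) (hN : 0 < N)
    (hγ : Function.Periodic γ N) : IsCompact (range γ) := by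
  rw [← hγ.image_Icc hN 0]
  exact isCompact_Icc.image hc

theorem eventually (hc : Continuous γ) (hN : 0 < N) (hγ : Function.Periodic γ N)
    (h : WindsAround γ N p w) : ∀ᶠ q in nhds p, WindsAround γ N q w := by
  have hp : p ∈ (range γ)ᶜ := by
    rintro ⟨t, ht⟩
    exact h.ne t ht
  obtain ⟨ε, hε, hball⟩ := Metric.isOpen_iff.1
    (isCompact_range_of_periodic hc hN hγ).isClosed.isOpen_compl p hp
  filter_upwards [Metric.ball_mem_nhds p hε] with q hq
  refine of_div_mem_slitPlane hc hγ h fun t => ?_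
  have hne := sub_ne_zero.2 (h.ne t)
  left
  have h1 : (γ t - q) / (γ t - p) = 1 + (p - q) / (γ t - p) := by field_simp; ring
  have h2 : ε ≤ ‖γ t - p‖ := by
    by_contra! hlt
    exact hball (by rwa [Metric.mem_ball, dist_eq_norm]) (mem_range_self t)
  have h3 : ‖(p - q) / (γ t - p)‖ < 1 := by
    rw [norm_div, div_lt_one (norm_pos_iff.2 hne)]
    rw [Metric.mem_ball, dist_comm, dist_eq_norm] at hq
    linarith
  have h4 := (abs_le.1 ((Complex.abs_re_le_norm ((p - q) / (γ t - p))))).1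
  rw [h1, Complex.add_re, Complex.one_re]
  linarith

theorem of_isPreconnected (hc : Continuous γ) (hN : 0 < N) (hγ : Function.Periodic γ N)
    {S : Set ℂ} (hS : IsPreconnected S) (hdisj : Disjoint S (range γ)) (hp : p ∈ S) (hq : q ∈ S)
    (h : WindsAround γ N p w) : WindsAround γ N q w := by
  refine hS.induction₂ (fun x y => ∀ w, WindsAround γ N x w → WindsAround γ N y w) ?_ ?_ ?_
    hp hq w h
  · intro x hx
    obtain ⟨v, hv⟩ := exists_of_forall_ne (p := x) hc hγ
      (fun t ht => disjoint_left.1 hdisj hx ⟨t, ht⟩)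
    filter_upwards [nhdsWithin_le_nhds (hv.eventually hc hN hγ)] with y hy u hu
    rwa [hu.unique hv]
  · intro x y z _ _ _ hxy hyz u hu
    exact hyz u (hxy u hu)
  · intro x y hx _ hxy u hu
    obtain ⟨v, hv⟩ := exists_of_forall_ne (p := x) hc hγ
      (fun t ht => disjoint_left.1 hdisj hx ⟨t, ht⟩)
    rwa [hu.unique (hxy v hv)]

/-- A simple closed curve winds at most once around the origin. -/
theorem le_one_of_injective (hc : Continuous γ) (hN : 0 < N) (hγ : Function.Periodic γ N)
    (hinj : ∀ s t, γ s = γ t → ∃ k : ℤ, s - t = k * N) (h : WindsAround γ N 0 w) : w ≤ 1 := by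
  by_contra! hw
  have hpi := Real.pi_pos
  obtain ⟨φ, hφ, hφw⟩ := h
  have hφc : Continuous φ := continuousOn_univ.1 hφ.1
  have hper : ∀ t, φ (t + N) = φ t + 2 * Real.pi * w := fun t => by
    have := hφ.add_period hγ t 0
    rw [zero_add, hφw] at this
    linarith
  have hpolar : ∀ t, γ t = (‖γ t‖ : ℂ) * Complex.exp ((φ t : ℂ) * Complex.I) := fun t => by
    have := (hφ.2 t (mem_univ t)).2
    simpa using this
  set ρ : ℝ → ℝ := fun t => ‖γ t‖ with hρ
  have hρc : Continuous ρ := hc.norm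
  have hρper : ∀ t, ρ (t + N) = ρ t := fun t => by simp [hρ, hγ t]
  -- In logarithmic-polar coordinates the curve lifts to the plane. `D` is the difference between
  -- the lift at `s` moved up by `2π` and the lift at `t`. A zero would give `t = s + kN` with `k *
  -- w = 1`, impossible for `w ≥ 2`; so `D` has a continuous argument `Θ` on the whole plane.
  set D : ℝ × ℝ → ℂ := fun x => (ρ x.1 - ρ x.2 : ℝ) + (φ x.1 + 2 * Real.pi - φ x.2 : ℝ) * Complex.I
    with hD
  have hDc : Continuous D := by
    simp only [hD]
    fun_prop
  have hDre : ∀ s t, (D (s, t)).re = ρ s - ρ t := fun s t => by simp [hD]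
  have hDim : ∀ s t, (D (s, t)).im = φ s + 2 * Real.pi - φ t := fun s t => by simp [hD]
  have hper' : ∀ (k : ℤ) t, φ (t + k * N) = φ t + 2 * Real.pi * (k * w) := by
    intro k t
    induction k using Int.induction_on with
    | zero => simp
    | succ k ih =>
      have := hper (t + k * N)
      push_cast at ih ⊢
      rw [show t + ((k : ℝ) + 1) * N = t + k * N + N by ring, this, ih]
      ring
    | pred k ih =>
      have := hper (t + (-(k : ℝ) - 1) * N)
      push_cast at ih ⊢
      rw [show t + (-(k : ℝ) - 1) * N + N = t + -(k : ℝ) * N by ring, ih] at this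
      linarith
  have hD0 : ∀ x, D x ≠ 0 := by
    rintro ⟨s, t⟩ h0
    have h1 : ρ s = ρ t := by
      have := hDre s t
      rw [h0, Complex.zero_re] at this
      linarith
    have h2 : φ t = φ s + 2 * Real.pi := by
      have := hDim s t
      rw [h0, Complex.zero_im] at this
      linarith
    have h3 : γ s = γ t := by
      rw [hpolar s, hpolar t, h2]
      simp only [hρ] at h1
      rw [h1]
      push_cast
      rw [add_mul, Complex.exp_add, Complex.exp_two_pi_mul_I, mul_one]
    obtain ⟨k, hk⟩ := hinj t s h3.symm
    have h4 := hper' k s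
    rw [show s + k * N = t by linarith, h2] at h4
    have h5 : (1 : ℝ) = k * w := by
      apply mul_left_cancel₀ (mul_ne_zero two_ne_zero hpi.ne')
      linarith
    have h6 : w * k = 1 := by
      rw [mul_comm]
      exact_mod_cast h5.symm
    have := Int.eq_one_or_neg_one_of_mul_eq_one h6
    omega
  obtain ⟨Θ, hΘ⟩ := exists_isAngleOn_real_prod hDc hD0
  have hΘc : Continuous Θ := continuousOn_univ.1 hΘ.1
  have hDpos : ∀ x, 0 < ‖D x‖ := fun x => norm_pos_iff.2 (hD0 x)
  have hcos : ∀ x, (D x).re = ‖D x‖ * Real.cos (Θ x) := fun x => by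
    conv_lhs => rw [(hΘ.2 x (mem_univ x)).2]
    rw [Complex.re_ofReal_mul, Complex.exp_ofReal_mul_I_re]
  have hsin : ∀ x, (D x).im = ‖D x‖ * Real.sin (Θ x) := fun x => by
    conv_lhs => rw [(hΘ.2 x (mem_univ x)).2]
    rw [Complex.im_ofReal_mul, Complex.exp_ofReal_mul_I_im]
  have hnorm : ∀ x, (D x).re = 0 → ‖D x‖ = |(D x).im| := fun x hx => by
    rw [← Complex.re_add_im (D x), hx]
    simp
  -- With `t₀` a maximum and `t₁` a minimum of the modulus, `D` is `2πi` at `(t₁, t₁)` and a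
  -- negative multiple of `i` at `(t₀, t₀ + N)`. Two L-shaped paths join these points, one with `Re
  -- D ≥ 0` and one with `Re D ≤ 0`; they change `Θ` by `-π` and by `+π`, a contradiction.
  obtain ⟨t₀, -, ht₀⟩ : ∃ t₀ ∈ Icc 0 N, ∀ t ∈ Icc 0 N, ρ t ≤ ρ t₀ :=
    isCompact_Icc.exists_isMaxOn (nonempty_Icc.2 hN.le) hρc.continuousOn
  have hmax : ∀ t, ρ t ≤ ρ t₀ := fun t => by
    obtain ⟨s, hs, hst⟩ := (show Function.Periodic ρ N from hρper).exists_mem_Ico₀ hN t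
    rw [hst]
    exact ht₀ s (Ico_subset_Icc_self hs)
  obtain ⟨t₁, ht₁, hmin'⟩ : ∃ t₁ ∈ Icc t₀ (t₀ + N), ∀ t ∈ Icc t₀ (t₀ + N), ρ t₁ ≤ ρ t :=
    isCompact_Icc.exists_isMinOn (nonempty_Icc.2 (by linarith)) hρc.continuousOn
  have hmin : ∀ t, ρ t₁ ≤ ρ t := fun t => by
    obtain ⟨s, hs, hst⟩ := (show Function.Periodic ρ N from hρper).exists_mem_Ico hN t t₀
    rw [hst]
    exact hmin' s (Ico_subset_Icc_self hs)
  have hx : Real.sin (Θ (t₁, t₁)) = 1 := by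
    have h1 := hsin (t₁, t₁)
    rw [hnorm _ (by rw [hDre, sub_self]), hDim, abs_of_pos (by linarith)] at h1
    have h2 : (2 * Real.pi) * Real.sin (Θ (t₁, t₁)) = (2 * Real.pi) * 1 := by linarith
    exact mul_left_cancel₀ (by positivity) h2
  have hy : Real.sin (Θ (t₀, t₀ + N)) = -1 := by
    have hw' : (2 : ℝ) ≤ w := by exact_mod_cast hw
    have h1 := hsin (t₀, t₀ + N)
    have hneg : φ t₀ + 2 * Real.pi - φ (t₀ + N) < 0 := by
      rw [hper]
      nlinarith
    rw [hnorm _ (by rw [hDre, hρper, sub_self]), hDim, abs_of_neg hneg] at h1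
    apply mul_left_cancel₀ (neg_ne_zero.2 hneg.ne)
    linarith
  have hpre : ∀ a b c : ℝ, IsPreconnected ((fun s : ℝ => (s, c)) '' Icc a b) := fun a b c =>
    isPreconnected_Icc.image _ (by fun_prop)
  have hpre' : ∀ a b c : ℝ, IsPreconnected ((fun s : ℝ => (c, s)) '' Icc a b) := fun a b c =>
    isPreconnected_Icc.image _ (by fun_prop)
  have e1 : Θ (t₀, t₀ + N) = Θ (t₁, t₁) - Real.pi := by
    refine IsAngleOn.eq_sub_pi (s := (fun s : ℝ => (s, t₁)) '' Icc t₀ t₁ ∪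
      (fun s : ℝ => (t₀, s)) '' Icc t₁ (t₀ + N))
      (IsPreconnected.union (t₀, t₁) ⟨t₀, ⟨le_rfl, ht₁.1⟩, rfl⟩ ⟨t₁, ⟨le_rfl, ht₁.2⟩, rfl⟩
        (hpre _ _ _) (hpre' _ _ _)) hΘc.continuousOn ?_
      (Or.inl ⟨t₁, ⟨ht₁.1, le_rfl⟩, rfl⟩) (Or.inr ⟨t₀ + N, ⟨ht₁.2, le_rfl⟩, rfl⟩) hx hy
    have : ∀ x, 0 ≤ (D x).re → 0 ≤ Real.cos (Θ x) := fun x hx => by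
      rw [hcos] at hx
      exact nonneg_of_mul_nonneg_right hx (hDpos x)
    rintro _ (⟨s, -, rfl⟩ | ⟨s, -, rfl⟩)
    · exact this _ (by rw [hDre]; linarith [hmin s])
    · exact this _ (by rw [hDre]; linarith [hmax s])
  have e2 : Θ (t₀, t₀ + N) = Θ (t₁, t₁) + Real.pi := by
    refine IsAngleOn.eq_add_pi (s := (fun s : ℝ => (t₁, s)) '' Icc t₁ (t₀ + N) ∪
      (fun s : ℝ => (s, t₀ + N)) '' Icc t₀ t₁)
      (IsPreconnected.union (t₁, t₀ + N) ⟨t₀ + N, ⟨ht₁.2, le_rfl⟩, rfl⟩ ⟨t₁, ⟨ht₁.1, le_rfl⟩, rfl⟩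
        (hpre' _ _ _) (hpre _ _ _)) hΘc.continuousOn ?_
      (Or.inl ⟨t₁, ⟨le_rfl, ht₁.2⟩, rfl⟩) (Or.inr ⟨t₀, ⟨le_rfl, ht₁.1⟩, rfl⟩) hx hy
    have : ∀ x, (D x).re ≤ 0 → Real.cos (Θ x) ≤ 0 := fun x hx => by
      rw [hcos] at hx
      by_contra! hlt
      nlinarith [mul_pos (hDpos x) hlt]
    rintro _ (⟨s, -, rfl⟩ | ⟨s, -, rfl⟩)
    · exact this _ (by rw [hDre]; linarith [hmin s])
    · exact this _ (by rw [hDre, hρper]; linarith [hmax s])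
  linarith

end WindsAround

/-! ### Nested curves. -/

namespace WindsAround

variable {γ : ℝ → ℂ} {N : ℝ}

/-- Of two disjoint closed curves winding once around the origin, the one reaching further out winds
once around the other one, which does not wind around it. -/
theorem of_forall_exists_norm_le {γ' : ℝ → ℂ} {N' : ℝ} (hc : Continuous γ) (hN : 0 < N)
    (hγ : Function.Periodic γ N) (hc' : Continuous γ') (hN' : 0 < N')
    (hγ' : Function.Periodic γ' N') (h : WindsAround γ N 0 1) (h' : WindsAround γ' N' 0 1)
    (hdisj : Disjoint (range γ) (range γ')) (hle : ∀ s, ∃ t, ‖γ s‖ ≤ ‖γ' t‖) :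
    (∀ s, WindsAround γ' N' (γ s) 1) ∧ ∀ t, WindsAround γ N (γ' t) 0 := by
  have hne : ∀ s t, γ s ≠ γ' t := fun s t hst =>
    disjoint_left.1 hdisj (mem_range_self s) ⟨t, hst.symm⟩
  have hK := isCompact_range_of_periodic hc hN hγ
  have hK' := isCompact_range_of_periodic hc' hN' hγ'
  have h2 : ∀ t, WindsAround γ N (γ' t) 0 := by
    -- At the outermost point of `γ'` the winding number of `γ` is 0, and it stays so along the
    -- connected curve `γ'`.
    obtain ⟨_, ⟨t₀, rfl⟩, ht₀⟩ := hK'.exists_isMaxOn (range_nonempty _) continuous_norm.continuousOn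
    refine fun t => of_isPreconnected hc hN hγ (isPreconnected_range hc') hdisj.symm
      (mem_range_self t₀) (mem_range_self t) (zero_of_norm_le hc hγ (fun s => ?_) fun s => hne s t₀)
    obtain ⟨t₁, ht₁⟩ := hle s
    exact ht₁.trans (ht₀ (mem_range_self t₁))
  refine ⟨?_, h2⟩
  obtain ⟨_, ⟨s₀, rfl⟩, hs₀⟩ := hK.exists_isMinOn (range_nonempty _) continuous_norm.continuousOn
  obtain ⟨_, ⟨t₀, rfl⟩, ht₀⟩ := hK'.exists_isMinOn (range_nonempty _) continuous_norm.continuousOn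
  refine fun s => of_isPreconnected hc' hN' hγ' (isPreconnected_range hc) hdisj
    (mem_range_self s₀) (mem_range_self s) (of_norm_le hc' hγ' h' (fun t => ?_)
      fun t => (hne s₀ t).symm)
  refine le_trans ?_ (ht₀ (mem_range_self t))
  -- If the innermost point of `γ'` were nearer to the origin than all of `γ`, then `γ` would wind
  -- once around it, against `h2`. So the innermost point of `γ` is no further out than all of `γ'`.
  by_contra! hlt
  have := of_norm_le (p := γ' t₀) hc hγ h (fun s => hlt.le.trans (hs₀ (mem_range_self s)))
    (fun s => hne s t₀)
  exact one_ne_zero (this.unique (h2 t₀))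

/-! ### Transverse crossings and paths across the annulus. -/

/-- The winding number computed from an arc where the curve stays in a slit plane, and an argument
along the complementary arc. -/
theorem exists_of_slitPlane (hc : Continuous γ) (hγ : Function.Periodic γ N) {p c : ℂ} {s δ : ℝ}
    (hδ : 0 < δ) (hδN : 2 * δ < N) {ψ : ℝ → ℝ}
    (hψ : IsAngleOn ψ (fun t => γ (s + t) - p) (Icc δ (N - δ))) (hc0 : c ≠ 0)
    (hslit : ∀ t ∈ Icc (-δ) δ, (γ (s + t) - p) / c ∈ Complex.slitPlane) :
    ∃ w : ℤ, WindsAround γ N p w ∧ 2 * Real.pi * w = ψ (N - δ) - ψ δ +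
      (((γ (s + δ) - p) / c).arg - ((γ (s - δ) - p) / c).arg) := by
  have hN : 0 < N := by linarith
  have hne : ∀ t, γ t ≠ p := by
    intro t
    obtain ⟨x, hx, hxt⟩ := (show Function.Periodic (fun x => γ (s + x)) N from
      fun x => by simp only [← add_assoc, hγ (s + x)]).exists_mem_Ico hN (t - s) (-δ)
    simp only [add_sub_cancel] at hxt
    rw [hxt]
    apply sub_ne_zero.1
    rcases le_total x δ with h | h
    · exact (div_ne_zero_iff.1 (Complex.slitPlane_ne_zero (hslit x ⟨hx.1, h⟩))).1
    · exact (hψ.2 x ⟨h, by linarith [hx.2]⟩).1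
  obtain ⟨φ, hφ⟩ := exists_isAngleOn_real (hc.sub continuous_const)
    (fun t => sub_ne_zero.2 (hne t))
  obtain ⟨w, hw⟩ := hφ.exists_winding (by simpa using hγ 0)
  refine ⟨w, ⟨φ, hφ, hw⟩, ?_⟩
  have hφ' : ∀ S, IsAngleOn (fun t => φ (s + t)) (fun t => γ (s + t) - p) S := fun S =>
    (hφ.comp (u := fun t => s + t) (by fun_prop) (mapsTo_univ _ univ)).mono (subset_univ _)
  have h1 := IsAngleOn.sub_eq_sub isPreconnected_Icc (hφ' _) hψ
    (x := N - δ) (y := δ) ⟨by linarith, le_rfl⟩ ⟨le_rfl, by linarith⟩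
  have h2 := IsAngleOn.sub_eq_sub isPreconnected_Icc (hφ' (Icc (-δ) δ))
    (((IsAngleOn.const hc0).mul (IsAngleOn.arg (f := fun t => (γ (s + t) - p) / c)
      (by fun_prop) hslit)).congr (fun t _ => mul_div_cancel₀ _ hc0))
    (x := δ) (y := -δ) ⟨by linarith, le_rfl⟩ ⟨le_rfl, by linarith⟩
  have h3 := hφ.add_period hγ 0 (s + -δ)
  rw [zero_add, hw, show s + -δ + N = s + (N - δ) by ring] at h3
  rw [sub_eq_add_neg s]
  linarith

/-- Winding numbers drop by one along a path that crosses a simple closed curve from left to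
right. -/
theorem exists_of_crossing (hc : Continuous γ) (hN : 0 < N) (hγ : Function.Periodic γ N)
    (hinj : ∀ s t, γ s = γ t → ∃ k : ℤ, s - t = k * N) {σ : ℝ → ℂ} {τ s r : ℝ} (hr : 0 < r)
    (hσ : ContinuousOn σ (Icc (τ - r) (τ + r))) (hmeet : σ τ = γ s)
    (hcross : AnnularGraph.PositiveCrossing σ τ γ s) :
    ∃ k : ℤ, ∃ η > 0, (∀ t ∈ Ioo (τ - η) τ, WindsAround γ N (σ t) (k + 1)) ∧
      ∀ t ∈ Ioo τ (τ + η), WindsAround γ N (σ t) k := by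
  have hpi := Real.pi_pos
  obtain ⟨u, v, hu, hv, huv⟩ := hcross
  have hu0 : u ≠ 0 := by
    rintro rfl
    simp at huv
  have hnu : 0 < ‖u‖ := norm_pos_iff.2 hu0
  set a := (v / u).re with ha
  set b := (v / u).im with hb
  have hb0 : 0 < b := by
    have h1 : v / u = (starRingEnd ℂ u * v) / (Complex.normSq u : ℂ) := by
      rw [Complex.normSq_eq_conj_mul_self]
      have : starRingEnd ℂ u ≠ 0 := by simpa using hu0
      field_simp
    rw [hb, h1, Complex.div_ofReal_im]
    exact div_pos huv (Complex.normSq_pos.2 hu0)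
  -- The bounds on the first-order error are what `hcone` and `hpos` need: `ε ≤ b / 2` gives `b|t| ≤
  -- 2ε|x|` when the imaginary part vanishes, and the other two keep the real part within `|x| / 2`
  -- of `-x`.
  obtain ⟨ε, hε, hε1, hε2, hε3⟩ : ∃ ε > 0, ε ≤ b / 2 ∧ ε ≤ 1 / 4 ∧ (|a| + 1) * (2 * ε) ≤ b / 4 := by
    have h1 : 0 < |a| + 1 := by positivity
    refine ⟨min (min (b / 2) (1 / 4)) (b / (8 * (|a| + 1))), by positivity,
      (min_le_left _ _).trans (min_le_left _ _), (min_le_left _ _).trans (min_le_right _ _), ?_⟩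
    have h2 : min (min (b / 2) (1 / 4)) (b / (8 * (|a| + 1))) ≤ b / (8 * (|a| + 1)) :=
      min_le_right _ _
    rw [le_div_iff₀ (by positivity)] at h2
    linarith
  have hγ1 : ∀ᶠ t in nhds (0 : ℝ), ‖γ (s + t) - γ s - t * v‖ ≤ ε * ‖u‖ * |t| := by
    have := (hasDerivAt_iff_isLittleO_nhds_zero.1 hv).def (c := ε * ‖u‖) (by positivity)
    simpa [Real.norm_eq_abs] using this
  have hσ1 : ∀ᶠ t in nhds (0 : ℝ), ‖σ (τ + t) - σ τ - t * u‖ ≤ ε * ‖u‖ * |t| := by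
    have := (hasDerivAt_iff_isLittleO_nhds_zero.1 hu).def (c := ε * ‖u‖) (by positivity)
    simpa [Real.norm_eq_abs] using this
  obtain ⟨δ₁, hδ₁, hγ2⟩ := Metric.eventually_nhds_iff.1 hγ1
  obtain ⟨δ₂, hδ₂, hσ2⟩ := Metric.eventually_nhds_iff.1 hσ1
  simp only [Real.dist_eq, sub_zero] at hγ2 hσ2
  obtain ⟨δ, hδ, hδδ, hδN⟩ : ∃ δ > 0, δ < δ₁ ∧ 2 * δ < N := by
    refine ⟨min (δ₁ / 2) (N / 4), by positivity, ?_, ?_⟩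
    · exact (min_le_left _ _).trans_lt (by linarith)
    · have := min_le_right (δ₁ / 2) (N / 4)
      linarith
  obtain ⟨m, hm, hfar⟩ : ∃ m > 0, ∀ t ∈ Icc δ (N - δ), m ≤ ‖γ (s + t) - γ s‖ := by
    obtain ⟨t₀, ht₀, hmin⟩ := isCompact_Icc.exists_isMinOn (nonempty_Icc.2 (by linarith))
      (f := fun t => ‖γ (s + t) - γ s‖) (s := Icc δ (N - δ)) (by fun_prop)
    refine ⟨_, norm_pos_iff.2 (sub_ne_zero.2 fun h => ?_), fun t ht => hmin ht⟩
    obtain ⟨k, hk⟩ := hinj _ _ h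
    rw [add_sub_cancel_left] at hk
    have h1 : (0 : ℝ) < k := by
      by_contra! hk0
      nlinarith [ht₀.1]
    have h2 : (k : ℝ) < 1 := by
      by_contra! hk0
      nlinarith [ht₀.2]
    have h1' : 0 < k := by exact_mod_cast h1
    have h2' : k < 1 := by exact_mod_cast h2
    omega
  have hσ3 : ∀ᶠ t in nhds (0 : ℝ), ‖σ (τ + t) - γ s‖ < m := by
    have h1 : ContinuousAt (fun t => ‖σ (τ + t) - γ s‖) 0 := by
      have h2 : ContinuousAt (fun t => σ (τ + t)) 0 :=
        ContinuousAt.comp (g := σ) (f := fun t => τ + t) (by simpa using hu.continuousAt)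
          (by fun_prop)
      exact (h2.sub continuousAt_const).norm
    refine h1.eventually_lt continuousAt_const ?_
    simpa [hmeet] using hm
  obtain ⟨δ₃, hδ₃, hσ4⟩ := Metric.eventually_nhds_iff.1 hσ3
  simp only [Real.dist_eq, sub_zero] at hσ4
  obtain ⟨η, hη, hηδ, hη₂, hη₃, hηr⟩ : ∃ η > 0, η < δ ∧ η < δ₂ ∧ η < δ₃ ∧ η ≤ r := by
    refine ⟨min (min (δ / 2) (δ₂ / 2)) (min (δ₃ / 2) r), by positivity, ?_, ?_, ?_, ?_⟩
    · exact ((min_le_left _ _).trans (min_le_left _ _)).trans_lt (by linarith)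
    · exact ((min_le_left _ _).trans (min_le_right _ _)).trans_lt (by linarith)
    · exact ((min_le_right _ _).trans (min_le_left _ _)).trans_lt (by linarith)
    · exact (min_le_right _ _).trans (min_le_right _ _)
  -- Division by `u` straightens the picture: to first order the path runs along the real axis at
  -- unit speed, and the curve crosses it upwards with velocity `a + bi`, `b > 0`.
  set G : ℝ → ℝ → ℂ := fun t x => (γ (s + t) - σ (τ + x)) / u with hG
  have hGerr : ∀ t x, |t| ≤ δ → |x| ≤ η → ‖G t x - (t * (v / u) - x)‖ ≤ ε * (|t| + |x|) := by
    intro t x ht hx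
    have h1 := hγ2 (y := t) (by linarith)
    have h2 := hσ2 (y := x) (by linarith)
    have h3 : G t x - (t * (v / u) - x) =
        ((γ (s + t) - γ s - t * v) - (σ (τ + x) - σ τ - x * u)) / u := by
      simp only [hG]
      rw [hmeet]
      field_simp
      ring
    rw [h3, norm_div, div_le_iff₀ hnu]
    refine (norm_sub_le _ _).trans ?_
    linarith
  have hGre : ∀ t x, |t| ≤ δ → |x| ≤ η → |(G t x).re - (a * t - x)| ≤ ε * (|t| + |x|) := by
    intro t x ht hx
    refine le_trans ?_ (hGerr t x ht hx)
    refine le_trans (le_of_eq ?_) (Complex.abs_re_le_norm _)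
    simp [ha, mul_comm]
  have hGim : ∀ t x, |t| ≤ δ → |x| ≤ η → |(G t x).im - b * t| ≤ ε * (|t| + |x|) := by
    intro t x ht hx
    refine le_trans ?_ (hGerr t x ht hx)
    refine le_trans (le_of_eq ?_) (Complex.abs_im_le_norm _)
    simp [hb, mul_comm]
  -- Seen from `σ (τ + x)`, the short arc of the curve crosses the real direction near `-x`: in
  -- front for `x < 0`, behind for `x > 0`.
  have hcone : ∀ t x, |t| ≤ δ → |x| ≤ η → (G t x).im = 0 →
      |(G t x).re + x| ≤ |x| / 2 := by
    intro t x ht hx h0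
    have h1 := hGre t x ht hx
    have h2 := hGim t x ht hx
    rw [h0, zero_sub, abs_neg, abs_mul, abs_of_pos hb0] at h2
    have h3 : |(G t x).re + x| ≤ |a| * |t| + ε * (|t| + |x|) := by
      rw [← abs_mul]
      refine le_trans (le_of_eq ?_) ((abs_add_le (a * t) ((G t x).re - (a * t - x))).trans
        (add_le_add_right h1 _))
      congr 1
      ring
    have ht0 := abs_nonneg t
    have hx0 := abs_nonneg x
    have ha0 := abs_nonneg a
    have h4 : b * |t| ≤ 2 * ε * |x| := by nlinarith
    have h5 : b * ((|a| + ε) * |t|) ≤ b * (|x| / 4) := by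
      calc b * ((|a| + ε) * |t|) = (|a| + ε) * (b * |t|) := by ring
        _ ≤ (|a| + ε) * (2 * ε * |x|) := by gcongr
        _ ≤ (|a| + 1) * (2 * ε) * |x| := by
          rw [mul_assoc (|a| + 1)]
          gcongr
          linarith
        _ ≤ b / 4 * |x| := by gcongr
        _ = b * (|x| / 4) := by ring
    have h6 := le_of_mul_le_mul_left h5 hb0
    nlinarith
  have hpos : ∀ x, |x| ≤ η → 0 < (G δ x).im := by
    intro x hx
    have h1 := (abs_le.1 (hGim δ x (abs_of_pos hδ).le hx)).1
    rw [abs_of_pos hδ] at h1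
    nlinarith [abs_nonneg x]
  have hneg : ∀ x, |x| ≤ η → (G (-δ) x).im < 0 := by
    intro x hx
    have h1 := (abs_le.1 (hGim (-δ) x (by rw [abs_neg, abs_of_pos hδ]) hx)).2
    rw [abs_neg, abs_of_pos hδ] at h1
    nlinarith [abs_nonneg x]
  have hσc : ContinuousOn (fun x => σ (τ + x)) (Icc (-η) η) := by
    refine hσ.comp (by fun_prop) fun x hx => ⟨?_, ?_⟩
    · linarith [hx.1]
    · linarith [hx.2]
  have hδ' : δ ≤ N - δ := by linarith
  have hη' : -η ≤ η := by linarith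
  -- Clamping both parameters with `projIcc` extends the difference on the far arc to the whole
  -- plane without zeros, so its argument can be chosen jointly continuous.
  set F : ℝ × ℝ → ℂ := fun y =>
    γ (s + projIcc δ (N - δ) hδ' y.1) - σ (τ + projIcc (-η) η hη' y.2) with hF
  have hFc : Continuous F := by
    refine Continuous.sub (by fun_prop) ?_
    exact (continuousOn_iff_continuous_domRestrict.1 hσc).comp
      ((continuous_projIcc (h := hη')).comp (continuous_snd (X := ℝ)))
  have hF0 : ∀ y, F y ≠ 0 := by
    intro y h0
    have h1 := hfar _ (projIcc δ (N - δ) hδ' y.1).2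
    have h2 := hσ4 (y := projIcc (-η) η hη' y.2)
      ((abs_le.2 (projIcc (-η) η hη' y.2).2).trans_lt hη₃)
    rw [sub_eq_zero.1 h0] at h1
    linarith
  obtain ⟨Θ, hΘ⟩ := exists_isAngleOn_real_prod hFc hF0
  have hΘc : Continuous Θ := continuousOn_univ.1 hΘ.1
  have hFeq : ∀ t ∈ Icc δ (N - δ), ∀ x ∈ Icc (-η) η, F (t, x) = γ (s + t) - σ (τ + x) := by
    intro t ht x hx
    simp only [hF]
    rw [projIcc_of_mem hδ' ht, projIcc_of_mem hη' hx]
  have hψ : ∀ x ∈ Icc (-η) η, IsAngleOn (fun t => Θ (t, x)) (fun t => γ (s + t) - σ (τ + x))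
      (Icc δ (N - δ)) := fun x hx =>
    ((hΘ.comp (u := fun t => (t, x)) (by fun_prop) (mapsTo_univ _ univ)).mono
      (subset_univ _)).congr (fun t ht => hFeq t ht x hx)
  -- Angle change along the far arc plus the difference of principal arguments at the ends of the
  -- short arc. The ends stay off the real axis, so `g` is continuous; its values lie in `2πℤ`, so
  -- it is constant even across `x = 0`.
  set g : ℝ → ℝ := fun x => Θ (N - δ, x) - Θ (δ, x) + ((G δ x).arg - (G (-δ) x).arg) with hg
  have hGc : ∀ t, ContinuousOn (fun x => G t x) (Icc (-η) η) := fun t =>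
    (continuousOn_const.sub hσc).div_const u
  have hgc : ContinuousOn g (Icc (-η) η) := by
    refine ContinuousOn.add (by fun_prop) (ContinuousOn.sub ?_ ?_)
    · exact (IsAngleOn.arg (hGc δ) fun x hx => Or.inr (hpos x (abs_le.2 hx)).ne').1
    · exact (IsAngleOn.arg (hGc (-δ)) fun x hx => Or.inr (hneg x (abs_le.2 hx)).ne).1
  have hgint : ∀ x ∈ Icc (-η) η, ∃ n : ℤ, g x = 2 * Real.pi * n := by
    intro x hx
    have key : ∀ t, G t x ≠ 0 → γ (s + t) - σ (τ + x) =
        (‖γ (s + t) - σ (τ + x)‖ : ℂ) * Complex.exp (((u.arg + (G t x).arg : ℝ) : ℂ) *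
          Complex.I) := by
      intro t ht
      have h1 : γ (s + t) - σ (τ + x) = u * G t x := (mul_div_cancel₀ _ hu0).symm
      rw [h1, norm_mul]
      push_cast
      rw [add_mul, Complex.exp_add]
      conv_lhs => rw [← Complex.norm_mul_exp_arg_mul_I u, ← Complex.norm_mul_exp_arg_mul_I (G t x)]
      ring
    have hG1 : G δ x ≠ 0 := fun h => (hpos x (abs_le.2 hx)).ne' (by rw [h]; rfl)
    have hG2 : G (-δ) x ≠ 0 := fun h => (hneg x (abs_le.2 hx)).ne (by rw [h]; rfl)
    have e1 := (hψ x hx).2 δ ⟨le_rfl, hδ'⟩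
    have e2 := (hψ x hx).2 (N - δ) ⟨hδ', le_rfl⟩
    beta_reduce at e2
    rw [show s + (N - δ) = s + -δ + N by ring, hγ] at e2
    obtain ⟨n₁, hn₁⟩ := exists_int_of_polar_eq e1.1 e1.2 (key δ hG1)
    obtain ⟨n₂, hn₂⟩ := exists_int_of_polar_eq e2.1 e2.2 (key (-δ) hG2)
    refine ⟨n₂ - n₁, ?_⟩
    push_cast
    simp only [hg]
    linarith
  obtain ⟨K, hK⟩ := hgint 0 ⟨by linarith, hη.le⟩
  have hgK : ∀ x ∈ Icc (-η) η, g x = 2 * Real.pi * K := fun x hx => by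
    rw [← hK]
    exact eq_of_continuousOn_of_forall_two_pi isPreconnected_Icc hgc hgint hx
      ⟨by linarith, hη.le⟩
  -- Before the crossing the short arc avoids the negative axis and `g` is the true total angle.
  -- After it the arc avoids the positive axis, so the arguments of `-G` count instead; they differ
  -- by `-π` at one end and `+π` at the other, which lowers the total by `2π`.
  refine ⟨K - 1, η, hη, fun t ht => ?_, fun t ht => ?_⟩
  · have hx : t - τ ∈ Icc (-η) η := ⟨by linarith [ht.1], by linarith [ht.2]⟩
    have hx0 : t - τ < 0 := by linarith [ht.2]
    obtain ⟨w, hw, hw'⟩ := exists_of_slitPlane hc hγ hδ hδN (hψ _ hx) hu0 (fun y hy => by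
      change G y (t - τ) ∈ _
      by_cases him : (G y (t - τ)).im = 0
      · left
        have := (abs_le.1 (hcone y _ (abs_le.2 hy) (abs_le.2 hx) him)).1
        rw [abs_of_neg hx0] at this
        linarith
      · exact Or.inr him)
    have h1 := hgK _ hx
    rw [add_sub_cancel] at hw
    have h2 : (w : ℝ) = K := by
      apply mul_left_cancel₀ (mul_ne_zero two_ne_zero hpi.ne')
      rw [hw', ← h1]
      rfl
    have h3 : w = K := by exact_mod_cast h2
    rwa [sub_add_cancel, ← h3]
  · have hx : t - τ ∈ Icc (-η) η := ⟨by linarith [ht.1], by linarith [ht.2]⟩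
    have hx0 : 0 < t - τ := by linarith [ht.1]
    have hGn : ∀ y, (γ (s + y) - σ (τ + (t - τ))) / (-u) = -G y (t - τ) := fun y => by
      simp only [hG, div_neg]
    obtain ⟨w, hw, hw'⟩ := exists_of_slitPlane hc hγ hδ hδN (hψ _ hx) (neg_ne_zero.2 hu0)
      (fun y hy => by
        rw [hGn]
        by_cases him : (G y (t - τ)).im = 0
        · left
          have := (abs_le.1 (hcone y _ (abs_le.2 hy) (abs_le.2 hx) him)).2
          rw [abs_of_pos hx0] at this
          rw [Complex.neg_re]
          linarith
        · exact Or.inr (by simpa using him))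
    have h1 := hgK _ hx
    rw [add_sub_cancel] at hw
    have h2 : (w : ℝ) = K - 1 := by
      apply mul_left_cancel₀ (mul_ne_zero two_ne_zero hpi.ne')
      rw [hw', hGn, sub_eq_add_neg s, hGn,
        Complex.arg_neg_eq_arg_sub_pi_of_im_pos (hpos _ (abs_le.2 hx)),
        Complex.arg_neg_eq_arg_add_pi_of_im_neg (hneg _ (abs_le.2 hx)), mul_sub, ← h1]
      simp only [hg]
      ring
    have h3 : w = K - 1 := by exact_mod_cast h2
    rwa [← h3]

end WindsAround

/-- By compactness a subinterval splits into finitely many pieces, each inside one of the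
neighbourhoods. -/
theorem antitoneOn_Icc_of_locally {a b : ℝ} {g : ℝ → ℤ}
    (h : ∀ x ∈ Icc a b, ∃ ε > 0, AntitoneOn g (Ioo (x - ε) (x + ε) ∩ Icc a b)) :
    AntitoneOn g (Icc a b) := by
  intro x hx y hy hxy
  have hsub : Icc x y ⊆ Icc a b := Icc_subset_Icc hx.1 hy.2
  choose ε hε hanti using fun z : Icc x y => h z (hsub z.2)
  obtain ⟨t, ht0, htm, ⟨m, hm⟩, hcov⟩ := exists_monotone_Icc_subset_open_cover_Icc hxy
    (c := fun z : Icc x y => (Subtype.val ⁻¹' Ioo (z.1 - ε z) (z.1 + ε z) : Set (Icc x y)))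
    (fun z => isOpen_Ioo.preimage continuous_subtype_val)
    (fun z _ => mem_iUnion.2 ⟨z, by simp [hε z]⟩)
  have key : ∀ n, g (t n) ≤ g x := by
    intro n
    induction n with
    | zero => rw [ht0]
    | succ n ih =>
      obtain ⟨z, hz⟩ := hcov n
      have hle := htm n.le_succ
      exact (hanti z ⟨hz ⟨le_rfl, hle⟩, hsub (t n).2⟩ ⟨hz ⟨hle, le_rfl⟩, hsub (t (n + 1)).2⟩
        hle).trans ih
  have := key m
  rwa [hm m le_rfl] at this

namespace WindsAround

variable {γ : ℝ → ℂ} {N : ℝ}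

/-- Along a path from the inner to the outer circle that crosses a simple closed curve only from
left to right, the winding numbers are antitone, and they drop at every crossing. -/
theorem exists_antitoneOn (hc : Continuous γ) (hN : 0 < N) (hγ : Function.Periodic γ N)
    (hinj : ∀ s t, γ s = γ t → ∃ k : ℤ, s - t = k * N) (h : WindsAround γ N 0 1)
    (hmem : ∀ t, 1 < ‖γ t‖ ∧ ‖γ t‖ < 2) {σ : ℝ → ℂ} (hσ : ContinuousOn σ (Icc 0 1))
    (hσ0 : ‖σ 0‖ = 1) (hσ1 : ‖σ 1‖ = 2)
    (hcross : ∀ t ∈ Icc (0 : ℝ) 1, ∀ s, σ t = γ s → AnnularGraph.PositiveCrossing σ t γ s) :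
    ∃ g : ℝ → ℤ, AntitoneOn g (Icc 0 1) ∧ g 0 = 1 ∧ g 1 = 0 ∧
      (∀ t ∈ Icc (0 : ℝ) 1, σ t ∉ range γ → WindsAround γ N (σ t) (g t)) ∧
      ∀ t ∈ Icc (0 : ℝ) 1, σ t ∈ range γ → ∀ s ∈ Ico 0 t, g t < g s := by
  have hend : ∀ t ∈ Icc (0 : ℝ) 1, σ t ∈ range γ → t ∈ Ioo (0 : ℝ) 1 := by
    rintro t ht ⟨s, hs⟩
    have hm := hmem s
    rw [hs] at hm
    refine ⟨lt_of_le_of_ne ht.1 ?_, lt_of_le_of_ne ht.2 ?_⟩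
    · rintro rfl
      linarith
    · rintro rfl
      linarith
  have hloc : ∀ t ∈ Icc (0 : ℝ) 1, ∃ k : ℤ, ∃ ε > 0,
      (∀ x ∈ Ioo t (t + ε) ∩ Icc 0 1, WindsAround γ N (σ x) k) ∧
      (σ t ∈ range γ → ∀ x ∈ Ioo (t - ε) t ∩ Icc 0 1, WindsAround γ N (σ x) (k + 1)) ∧
      (σ t ∉ range γ → ∀ x ∈ Ioo (t - ε) (t + ε) ∩ Icc 0 1, WindsAround γ N (σ x) k) := by
    intro t ht
    by_cases hmeet : σ t ∈ range γ
    · obtain ⟨s, hs⟩ := hmeet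
      have ht' := hend t ht ⟨s, hs⟩
      obtain ⟨k, η, hη, h1, h2⟩ := exists_of_crossing hc hN hγ hinj
        (r := min t (1 - t)) (lt_min ht'.1 (by linarith [ht'.2]))
        (hσ.mono (Icc_subset_Icc (by linarith [min_le_left t (1 - t)])
          (by linarith [min_le_right t (1 - t)]))) hs.symm (hcross t ht s hs.symm)
      exact ⟨k, η, hη, fun x hx => h2 x hx.1, fun _ x hx => h1 x hx.1,
        fun hn => absurd ⟨s, hs⟩ hn⟩
    · obtain ⟨k, hk⟩ := exists_of_forall_ne (p := σ t) hc hγ fun s hs => hmeet ⟨s, hs⟩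
      have hev := (hσ t ht).eventually (hk.eventually hc hN hγ)
      obtain ⟨ε, hε, hball⟩ := Metric.mem_nhdsWithin_iff.1 hev
      rw [Real.ball_eq_Ioo] at hball
      exact ⟨k, ε, hε, fun x hx => hball ⟨⟨by linarith [hx.1.1], hx.1.2⟩, hx.2⟩,
        fun hp => absurd hp hmeet, fun _ x hx => hball hx⟩
  -- At a crossing, where the winding number is undefined, `g` takes the value just after it. The
  -- drop is then already visible at the crossing time.
  choose! g ε hε hright hleft hoff using hloc
  have hval : ∀ t ∈ Icc (0 : ℝ) 1, σ t ∉ range γ → WindsAround γ N (σ t) (g t) := fun t ht hn =>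
    hoff t ht hn t ⟨⟨by linarith [hε t ht], by linarith [hε t ht]⟩, ht⟩
  have heq : ∀ t ∈ Icc (0 : ℝ) 1, ∀ k, WindsAround γ N (σ t) k → g t = k := fun t ht k hk =>
    (hval t ht fun ⟨s, hs⟩ => hk.ne s hs).unique hk
  have hanti : AntitoneOn g (Icc 0 1) := by
    refine antitoneOn_Icc_of_locally fun t ht => ⟨ε t, hε t ht, ?_⟩
    have hgt : ∀ x ∈ Ioo t (t + ε t) ∩ Icc 0 1, g x = g t := fun x hx =>
      heq x hx.2 _ (hright t ht x hx)
    have hlt : ∃ k, g t ≤ k ∧ ∀ x ∈ Ioo (t - ε t) t ∩ Icc 0 1, g x = k := by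
      by_cases hmeet : σ t ∈ range γ
      · exact ⟨g t + 1, by omega, fun x hx => heq x hx.2 _ (hleft t ht hmeet x hx)⟩
      · exact ⟨g t, le_rfl, fun x hx => heq x hx.2 _
          (hoff t ht hmeet x ⟨⟨hx.1.1, by linarith [hx.1.2, hε t ht]⟩, hx.2⟩)⟩
    obtain ⟨k, hk, hlt⟩ := hlt
    intro x hx y hy hxy
    have hx' : (x < t ∧ g x = k) ∨ (t ≤ x ∧ g x = g t) := by
      rcases lt_trichotomy x t with h | h | h
      · exact Or.inl ⟨h, hlt x ⟨⟨hx.1.1, h⟩, hx.2⟩⟩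
      · exact Or.inr ⟨h.ge, by rw [h]⟩
      · exact Or.inr ⟨h.le, hgt x ⟨⟨h, hx.1.2⟩, hx.2⟩⟩
    have hy' : (y < t ∧ g y = k) ∨ (t ≤ y ∧ g y = g t) := by
      rcases lt_trichotomy y t with h | h | h
      · exact Or.inl ⟨h, hlt y ⟨⟨hy.1.1, h⟩, hy.2⟩⟩
      · exact Or.inr ⟨h.ge, by rw [h]⟩
      · exact Or.inr ⟨h.le, hgt y ⟨⟨h, hy.1.2⟩, hy.2⟩⟩
    rcases hx' with ⟨h1, h2⟩ | ⟨h1, h2⟩ <;> rcases hy' with ⟨h3, h4⟩ | ⟨h3, h4⟩ <;>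
      first | omega | linarith
  have h0 : (0 : ℝ) ∈ Icc (0 : ℝ) 1 := by simp
  have h1 : (1 : ℝ) ∈ Icc (0 : ℝ) 1 := by simp
  refine ⟨g, hanti, heq 0 h0 1 ?_, heq 1 h1 0 ?_, hval, fun t ht hmeet s hs => ?_⟩
  · refine of_norm_le hc hγ h (fun t => by linarith [(hmem t).1]) fun t ht => ?_
    have := (hmem t).1
    rw [ht] at this
    linarith
  · refine zero_of_norm_le hc hγ (fun t => by linarith [(hmem t).2]) fun t ht => ?_
    have := (hmem t).2
    rw [ht] at this
    linarith
  · have hεt := hε t ht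
    have hst : max s (t - ε t) < t := max_lt hs.2 (by linarith)
    obtain ⟨x, hx1, hx2⟩ := exists_between hst
    have hsx : s < x := (le_max_left _ _).trans_lt hx1
    have hx : x ∈ Icc (0 : ℝ) 1 := ⟨by linarith [hs.1], by linarith [ht.2]⟩
    have h2 := heq x hx _ (hleft t ht hmeet x ⟨⟨(le_max_right _ _).trans_lt hx1, hx2⟩, hx⟩)
    have h3 := hanti (a := s) ⟨hs.1, by linarith [hx.2]⟩ hx hsx.le
    omega

theorem existsUnique_crossing (hc : Continuous γ) (hN : 0 < N) (hγ : Function.Periodic γ N)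
    (hinj : ∀ s t, γ s = γ t → ∃ k : ℤ, s - t = k * N) (h : WindsAround γ N 0 1)
    (hmem : ∀ t, 1 < ‖γ t‖ ∧ ‖γ t‖ < 2) {σ : ℝ → ℂ} (hσ : ContinuousOn σ (Icc 0 1))
    (hσ0 : ‖σ 0‖ = 1) (hσ1 : ‖σ 1‖ = 2)
    (hcross : ∀ t ∈ Icc (0 : ℝ) 1, ∀ s, σ t = γ s → AnnularGraph.PositiveCrossing σ t γ s) :
    ∃! t, t ∈ Icc (0 : ℝ) 1 ∧ σ t ∈ range γ := by
  obtain ⟨g, hanti, hg0, hg1, hval, hdrop⟩ :=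
    exists_antitoneOn hc hN hγ hinj h hmem hσ hσ0 hσ1 hcross
  have h0 : (0 : ℝ) ∈ Icc (0 : ℝ) 1 := by simp
  have h1 : (1 : ℝ) ∈ Icc (0 : ℝ) 1 := by simp
  have hpos : ∀ t ∈ Icc (0 : ℝ) 1, σ t ∈ range γ → 0 < t := by
    rintro t ht ⟨s, hs⟩
    refine lt_of_le_of_ne ht.1 ?_
    rintro rfl
    have := (hmem s).1
    rw [hs, hσ0] at this
    linarith
  -- Two crossings would bring `g` from 1 down to at most -1, but it ends at 0.
  have huniq : ∀ s ∈ Icc (0 : ℝ) 1, ∀ t ∈ Icc (0 : ℝ) 1, σ s ∈ range γ → σ t ∈ range γ →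
      ¬ s < t := by
    intro s hs t ht hs' ht' hst
    have e1 := hdrop t ht ht' s ⟨hs.1, hst⟩
    have e2 := hdrop s hs hs' 0 ⟨le_rfl, hpos s hs hs'⟩
    have e3 := hanti ht h1 ht.2
    omega
  have hex : ∃ t, t ∈ Icc (0 : ℝ) 1 ∧ σ t ∈ range γ := by
    by_contra! hno
    have hdisj : Disjoint (σ '' Icc 0 1) (range γ) := by
      rw [disjoint_left]
      rintro _ ⟨t, ht, rfl⟩
      exact hno t ht
    have e0 := hval 0 h0 (hno 0 h0)
    have e1 := hval 1 h1 (hno 1 h1)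
    rw [hg0] at e0
    rw [hg1] at e1
    have := of_isPreconnected hc hN hγ (isPreconnected_Icc.image _ hσ) hdisj
      (mem_image_of_mem _ h0) (mem_image_of_mem _ h1) e0
    exact one_ne_zero (this.unique e1)
  obtain ⟨t, ht, ht'⟩ := hex
  exact ⟨t, ⟨ht, ht'⟩, fun s hs => le_antisymm (not_lt.1 (huniq t ht s hs.1 ht' hs.2))
    (not_lt.1 (huniq s hs.1 t ht hs.2 ht'))⟩

theorem crossing_lt (hc : Continuous γ) (hN : 0 < N) (hγ : Function.Periodic γ N)
    (hinj : ∀ s t, γ s = γ t → ∃ k : ℤ, s - t = k * N) (h : WindsAround γ N 0 1)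
    (hmem : ∀ t, 1 < ‖γ t‖ ∧ ‖γ t‖ < 2) {σ : ℝ → ℂ} (hσ : ContinuousOn σ (Icc 0 1))
    (hσ0 : ‖σ 0‖ = 1) (hσ1 : ‖σ 1‖ = 2)
    (hcross : ∀ t ∈ Icc (0 : ℝ) 1, ∀ s, σ t = γ s → AnnularGraph.PositiveCrossing σ t γ s)
    {s t : ℝ} (hs : s ∈ Icc (0 : ℝ) 1) (ht : t ∈ Icc (0 : ℝ) 1)
    (hs' : WindsAround γ N (σ s) 1) (ht' : σ t ∈ range γ) : s < t := by
  obtain ⟨g, hanti, hg0, hg1, hval, hdrop⟩ :=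
    exists_antitoneOn hc hN hγ hinj h hmem hσ hσ0 hσ1 hcross
  by_contra! hts
  have ht0 : 0 < t := by
    refine lt_of_le_of_ne ht.1 ?_
    rintro rfl
    obtain ⟨x, hx⟩ := ht'
    have := (hmem x).1
    rw [hx, hσ0] at this
    linarith
  have e1 := hdrop t ht ht' 0 ⟨le_rfl, ht0⟩
  have e2 := hanti ht hs hts
  have e3 := hs'.unique (hval s hs fun ⟨x, hx⟩ => hs'.ne x hx)
  omega

end WindsAround

/-! ### Cyclic words, periodic orbits and finite graphs. -/

namespace Cycle

variable {α : Type*} {r : α → α → Prop}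

/-- Unrolling to a periodic sequence indexed by `ℤ` makes successor and predecessor uniform, with no
special case at the closing step. -/
theorem Chain.exists_unroll {c : Cycle α} (hc : c ≠ Cycle.nil) (h : c.Chain r) :
    ∃ (N : ℕ) (ℓ : ℤ → α), 0 < N ∧ (∀ i, ℓ (i + N) = ℓ i) ∧
      c = (((List.range N).map fun k : ℕ => ℓ k : List α) : Cycle α) ∧
      ∀ i, r (ℓ i) (ℓ (i + 1)) := by
  induction c using Cycle.induction_on with
  | nil => exact absurd rfl hc
  | cons a m _ =>
    obtain ⟨n, hn⟩ : ∃ n, (a :: m).length = n + 1 := ⟨_, rfl⟩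
    have hpos : (0 : ℤ) < (n + 1 : ℕ) := by positivity
    have hlt : ∀ i : ℤ, (i % (n + 1 : ℕ)).toNat < (a :: m).length := fun i => by
      have h1 := Int.emod_nonneg i hpos.ne'
      have h2 := Int.emod_lt_of_pos i hpos
      omega
    set ℓ : ℤ → α := fun i => (a :: m)[(i % (n + 1 : ℕ)).toNat]'(hlt i) with hℓ
    have hper : ∀ i, ℓ (i + (n + 1 : ℕ)) = ℓ i := fun i => by simp [hℓ]
    have hnat : ∀ k : ℕ, (hk : k < (a :: m).length) → ℓ k = (a :: m)[k] := fun k hk => by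
      simp only [hℓ]
      congr 1
      rw [Int.emod_eq_of_lt (by positivity) (by exact_mod_cast hn ▸ hk)]
      rfl
    have hlist : (a :: m) = (List.range (n + 1)).map fun k : ℕ => ℓ k := by
      apply List.ext_getElem
      · simp [hn]
      · intro k h1 h2
        rw [List.getElem_map, List.getElem_range, hnat k h1]
    refine ⟨n + 1, ℓ, n.succ_pos, hper, congrArg _ hlist, ?_⟩
    rw [hlist, ← Cycle.map_coe, Cycle.chain_map, Cycle.chain_range_succ] at h
    have hnat' : ∀ k : ℕ, k < n + 1 → r (ℓ k) (ℓ (k + 1)) := by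
      intro k hk
      rcases Nat.lt_succ_iff_lt_or_eq.1 hk with hk | rfl
      · exact_mod_cast h.2 k hk
      · have := hper 0
        push_cast at this
        rw [zero_add] at this
        rw [this]
        exact_mod_cast h.1
    intro i
    have h1 := Int.emod_nonneg i hpos.ne'
    have h2 := Int.emod_lt_of_pos i hpos
    have h3 := hnat' (i % (n + 1 : ℕ)).toNat (by omega)
    rw [Int.toNat_of_nonneg h1] at h3
    have e1 : ℓ (i % (n + 1 : ℕ)) = ℓ i := by simp [hℓ]
    have e2 : ℓ (i % (n + 1 : ℕ) + 1) = ℓ (i + 1) := by simp [hℓ]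
    rwa [e1, e2] at h3

theorem Chain.reverse {c : Cycle α} (h : c.Chain r) : c.reverse.Chain (fun x y => r y x) := by
  induction c using Cycle.induction_on with
  | nil => trivial
  | cons a m _ =>
    rw [chain_coe_cons] at h
    have h1 := List.isChain_reverse.2 h
    rw [reverse_coe, List.reverse_cons, ← coe_cons_eq_coe_append, chain_coe_cons]
    simpa using! h1

theorem reverse_eq_flatten_replicate {c : Cycle α} {m : List α} {k : ℕ}
    (h : c.reverse = (((List.replicate k m).flatten : List α) : Cycle α)) :
    c = (((List.replicate k m.reverse).flatten : List α) : Cycle α) := by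
  rw [← reverse_reverse c, h, reverse_coe, List.reverse_flatten, List.map_replicate,
    List.reverse_replicate]

theorem Nodup.eq_one_of_eq_flatten_replicate {c : Cycle α} (hc : c ≠ Cycle.nil) (hn : c.Nodup)
    {m : List α} {k : ℕ} (h : c = (((List.replicate k m).flatten : List α) : Cycle α)) :
    k = 1 := by
  match k with
  | 0 => exact absurd (by simpa using h) hc
  | 1 => rfl
  | k + 2 =>
    rw [h, nodup_coe_iff, List.replicate_succ, List.flatten_cons, List.replicate_succ,
      List.flatten_cons] at hn
    have hm : m = [] := List.eq_nil_iff_forall_not_mem.2 fun x hx =>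
      List.disjoint_of_nodup_append hn hx (List.mem_append_left _ hx)
    subst hm
    exact absurd (by simpa using h) hc

theorem _root_.List.map_range_mul_eq_flatten {f : ℕ → α} {d : ℕ} (hf : ∀ i, f (i + d) = f i)
    (k : ℕ) : (List.range (d * k)).map f = (List.replicate k ((List.range d).map f)).flatten := by
  induction k with
  | zero => simp
  | succ k ih =>
    have hf' : ∀ k i, f (d * k + i) = f i := fun k i => by
      induction k with
      | zero => simp
      | succ k ih => rw [← ih, ← hf (d * k + i)]; congr 1; ring
    rw [Nat.mul_succ, List.range_add, List.map_append, ih, List.replicate_succ', List.flatten_append,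
      List.map_map]
    simp [Function.comp_def, hf']

/-- Each entry determines the next, so the word is a power of a minimal orbit of `f`; primitivity
makes the exponent 1. Starting at another entry only rotates the orbit. -/
theorem Chain.eq_periodicOrbit {c : Cycle α} (hc : c ≠ Cycle.nil) {f : α → α}
    (h : c.Chain fun x y => y = f x)
    (hprim : ∀ (m : List α) (k : ℕ), c = (((List.replicate k m).flatten : List α) : Cycle α) →
      k = 1) {x : α} (hx : x ∈ c) :
    x ∈ Function.periodicPts f ∧ c = Function.periodicOrbit f x := by
  obtain ⟨N, ℓ, hN, hper, hcl, hr⟩ := h.exists_unroll hc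
  have hiter : ∀ k : ℕ, ℓ k = f^[k] (ℓ 0) := fun k => by
    induction k with
    | zero => simp
    | succ k ih => rw [Function.iterate_succ_apply', ← ih, ← hr]; simp
  have hpp : Function.IsPeriodicPt f N (ℓ 0) := by
    have := hper 0
    rw [zero_add, hiter] at this
    exact this
  have hmem : ℓ 0 ∈ Function.periodicPts f := Function.mk_mem_periodicPts hN hpp
  obtain ⟨k, hk⟩ := hpp.minimalPeriod_dvd
  have h1 : c = (((List.range N).map fun k => f^[k] (ℓ 0) : List α) : Cycle α) := by
    rw [hcl]
    simp only [hiter]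
  have h2 : c = Function.periodicOrbit f (ℓ 0) := by
    have h3 := h1
    rw [hk, List.map_range_mul_eq_flatten (fun i => by
      rw [Function.iterate_add_apply, Function.iterate_minimalPeriod])] at h3
    rw [hprim _ _ h3, mul_one] at hk
    rw [h1, hk]
    rfl
  rw [h2, Function.mem_periodicOrbit_iff hmem] at hx
  obtain ⟨n, rfl⟩ := hx
  refine ⟨?_, by rw [Function.periodicOrbit_apply_iterate_eq hmem, h2]⟩
  rw [Function.mem_periodicPts] at hmem ⊢
  obtain ⟨n', hn', hp⟩ := hmem
  exact ⟨n', hn', hp.apply_iterate n⟩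

/-- Iterates of a self-map of a finite type become periodic, and a minimal orbit has no repetitions.
-/
theorem exists_nodup_chain [Finite α] {f : α → α} (hf : ∀ x, r x (f x)) {S : Set α}
    (hS : ∀ x ∈ S, f x ∈ S) {x : α} (hx : x ∈ S) :
    ∃ c : Cycle α, c ≠ nil ∧ c.Nodup ∧ c.Chain r ∧ ∀ y ∈ c, y ∈ S := by
  obtain ⟨i, j, hij, heq⟩ := Finite.exists_ne_map_eq_of_infinite fun n : ℕ => f^[n] x
  have hiter : ∀ n, f^[n] x ∈ S := fun n => by
    induction n with
    | zero => exact hx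
    | succ n ih => rw [Function.iterate_succ_apply']; exact hS _ ih
  have key : ∃ n, f^[n] x ∈ Function.periodicPts f := by
    wlog h : i < j generalizing i j
    · exact this j i hij.symm heq.symm (lt_of_le_of_ne (not_lt.1 h) hij.symm)
    refine ⟨i, Function.mk_mem_periodicPts (n := j - i) (by omega) ?_⟩
    rw [Function.IsPeriodicPt, Function.IsFixedPt, ← Function.iterate_add_apply,
      Nat.sub_add_cancel h.le]
    exact heq.symm
  obtain ⟨n, hn⟩ := key
  refine ⟨Function.periodicOrbit f (f^[n] x), fun h =>
    (Function.periodicOrbit_eq_nil_iff_not_periodic_pt.1 h) hn, Function.nodup_periodicOrbit, ?_, ?_⟩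
  · rw [Function.periodicOrbit_chain]
    intro k _
    rw [Function.iterate_succ_apply']
    exact hf _
  · intro y hy
    rw [Function.mem_periodicOrbit_iff hn] at hy
    obtain ⟨k, rfl⟩ := hy
    rw [← Function.iterate_add_apply]
    exact hiter _

end Cycle

/-- Following the only outgoing edge is a self-map of the finite set `K`. Positive indegree makes it
surjective, hence injective, so no vertex can have two incoming edges. With `src` and `tgt`
exchanged this excludes components consisting only of splits. -/
theorem eq_empty_of_outdegree_one_of_indegree_two {V E : Type*} [Finite V]
    {src tgt : E → V} {K : Set V} (hK : ∀ e, src e ∈ K ↔ tgt e ∈ K)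
    (hsrc : ∀ v ∈ K, ∃! e, src e = v) (htgt : ∀ v ∈ K, {e | tgt e = v}.ncard = 2) : K = ∅ := by
  refine eq_empty_of_forall_notMem fun v hv => ?_
  have : Nonempty E := ⟨(hsrc v hv).exists.choose⟩
  choose! out hout using fun v hv => (hsrc v hv).exists
  have huniq : ∀ e, src e ∈ K → e = out (src e) := fun e he =>
    (hsrc _ he).unique rfl (hout _ he)
  have hmaps : MapsTo (fun v => tgt (out v)) K K := fun v hv =>
    (hK _).1 (by rw [hout v hv]; exact hv)
  have hsurj : SurjOn (fun v => tgt (out v)) K K := fun v hv => by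
    obtain ⟨e, he⟩ : {e | tgt e = v}.Nonempty :=
      nonempty_of_ncard_ne_zero (by rw [htgt v hv]; norm_num)
    have hs : src e ∈ K := (hK e).2 (by rw [show tgt e = v from he]; exact hv)
    refine ⟨src e, hs, ?_⟩
    change tgt (out (src e)) = v
    rw [← huniq e hs]
    exact he
  have hinj : InjOn (fun v => tgt (out v)) K :=
    (((Set.toFinite K).surjOn_iff_bijOn_of_mapsTo hmaps).1 hsurj).injOn
  obtain ⟨e, f, hef, hset⟩ := ncard_eq_two.1 (htgt v hv)
  have he : tgt e = v := (hset ▸ (by simp) : e ∈ {e | tgt e = v})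
  have hf : tgt f = v := (hset ▸ (by simp) : f ∈ {e | tgt e = v})
  have hse : src e ∈ K := (hK e).2 (he ▸ hv)
  have hsf : src f ∈ K := (hK f).2 (hf ▸ hv)
  have he' := huniq e hse
  have hf' := huniq f hsf
  have h1 : src e = src f := hinj hse hsf (by
    change tgt (out (src e)) = tgt (out (src f))
    rw [← he', ← hf', he, hf])
  exact hef (by rw [he', hf', h1])

theorem List.Nodup.dvd_sub_of_periodic {α : Type*} {N : ℕ} (hN : 0 < N) {ℓ : ℤ → α}
    (hper : ∀ i, ℓ (i + N) = ℓ i) (hn : ((List.range N).map fun k : ℕ => ℓ k).Nodup) {i j : ℤ}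
    (h : ℓ i = ℓ j) : (N : ℤ) ∣ i - j := by
  have hpos : (0 : ℤ) < N := by exact_mod_cast hN
  have hmod : ∀ i : ℤ, ℓ ((i % N).toNat : ℤ) = ℓ i := fun i => by
    rw [Int.toNat_of_nonneg (Int.emod_nonneg i hpos.ne')]
    have h3 := ((show Function.Periodic ℓ (N : ℤ) from hper).int_mul (i / N)) (i % N)
    rw [← h3, Int.cast_id, mul_comm, Int.emod_add_mul_ediv]
  have hlt : ∀ i : ℤ, (i % N).toNat ∈ List.range N := fun i => by
    have h1 := Int.emod_nonneg i hpos.ne'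
    have h2 := Int.emod_lt_of_pos i hpos
    rw [List.mem_range]
    omega
  have h1 := List.inj_on_of_nodup_map hn (hlt i) (hlt j) (by rw [hmod, hmod, h])
  have h2 := Int.emod_nonneg i hpos.ne'
  have h3 := Int.emod_nonneg j hpos.ne'
  exact Int.ModEq.dvd (show j ≡ i [ZMOD N] by
    rw [Int.ModEq]
    omega)

/-! ### Combinatorics of directed cycles. -/

namespace AnnularGraph

variable {V E L : Type*} {G : AnnularGraph V E L}

theorem IsSplit.eq_of_tgt {v : V} (h : G.IsSplit v) {e f : E} (he : G.tgt e = v)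
    (hf : G.tgt f = v) : e = f :=
  h.1.unique he hf

theorem IsMerge.eq_of_src {v : V} (h : G.IsMerge v) {e f : E} (he : G.src e = v)
    (hf : G.src f = v) : e = f :=
  h.2.unique he hf

theorem IsSplit.not_isMerge {v : V} (h : G.IsSplit v) : ¬ G.IsMerge v := by
  rintro ⟨h2, -⟩
  obtain ⟨e, f, hef, hset⟩ := ncard_eq_two.1 h2
  exact hef (h.eq_of_tgt (hset ▸ (by simp) : e ∈ {e | G.tgt e = v})
    (hset ▸ (by simp) : f ∈ {e | G.tgt e = v}))

namespace IsAnnularStrandDiagram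

theorem exists_src_eq (hG : G.IsAnnularStrandDiagram) (v : V) : ∃ e, G.src e = v := by
  rcases hG.split_or_merge v with h | h
  · have h2 : {e | G.src e = v}.Nonempty := nonempty_of_ncard_ne_zero (by rw [h.2]; norm_num)
    exact h2
  · exact h.2.exists

theorem exists_tgt_eq (hG : G.IsAnnularStrandDiagram) (v : V) : ∃ e, G.tgt e = v := by
  rcases hG.split_or_merge v with h | h
  · exact h.1.exists
  · have h2 : {e | G.tgt e = v}.Nonempty := nonempty_of_ncard_ne_zero (by rw [h.1]; norm_num)
    exact h2

theorem isMerge_tgt (hG : G.IsAnnularStrandDiagram) (hred : G.IsReduced) {e : E}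
    (h : G.IsMerge (G.src e)) : G.IsMerge (G.tgt e) :=
  (hG.split_or_merge _).resolve_left fun hs => hred.1 ⟨e, h, hs⟩

theorem isSplit_src (hG : G.IsAnnularStrandDiagram) (hred : G.IsReduced) {e : E}
    (h : G.IsSplit (G.tgt e)) : G.IsSplit (G.src e) :=
  (hG.split_or_merge _).resolve_right fun hm => hred.1 ⟨e, hm, h⟩

end IsAnnularStrandDiagram

namespace DirectedCycle

/-- The edges of a directed cycle; there are none if and only if it is a free loop. -/
def edgeSet : G.DirectedCycle → Set E
  | walk c _ _ _ => {e | e ∈ c}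
  | free _ => ∅

theorem _root_.AnnularGraph.exists_cycle_of_forward [Finite E] (hG : G.IsAnnularStrandDiagram)
    {R : Set V} (hR : ∀ e, G.src e ∈ R → G.tgt e ∈ R) {v : V} (hv : v ∈ R) :
    ∃ a : G.DirectedCycle, a.edgeSet.Nonempty ∧ ∀ e ∈ a.edgeSet, G.src e ∈ R := by
  choose out hout using hG.exists_src_eq
  obtain ⟨c, hc, hn, hch, hmem⟩ := Cycle.exists_nodup_chain (r := fun e f => G.tgt e = G.src f)
    (f := fun e => out (G.tgt e)) (fun e => (hout _).symm) (S := {e | G.src e ∈ R})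
    (fun e he => by simpa [hout] using hR e he) (x := out v) (by simpa [hout] using hv)
  refine ⟨walk c hc hch fun m k h => hn.eq_one_of_eq_flatten_replicate hc h, ?_, hmem⟩
  obtain ⟨N, ℓ, hN, -, hcl, -⟩ := hch.exists_unroll hc
  exact ⟨ℓ (0 : ℕ), by
    change _ ∈ c
    rw [hcl, Cycle.mem_coe_iff]
    exact List.mem_map_of_mem (List.mem_range.2 hN)⟩

/-- A chosen incoming edge at each vertex is iterated; the resulting periodic orbit runs against the
arrows and has to be reversed. -/
theorem _root_.AnnularGraph.exists_cycle_of_backward [Finite E] (hG : G.IsAnnularStrandDiagram)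
    {R : Set V} (hR : ∀ e, G.tgt e ∈ R → G.src e ∈ R) {v : V} (hv : v ∈ R) :
    ∃ a : G.DirectedCycle, a.edgeSet.Nonempty ∧ ∀ e ∈ a.edgeSet, G.src e ∈ R := by
  choose inn hinn using hG.exists_tgt_eq
  obtain ⟨c, hc, hn, hch, hmem⟩ := Cycle.exists_nodup_chain (r := fun e f => G.tgt f = G.src e)
    (f := fun e => inn (G.src e)) (fun e => hinn _) (S := {e | G.src e ∈ R})
    (fun e he => hR _ (by simpa [hinn] using he)) (x := inn v) (hR _ (by simpa [hinn] using hv))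
  have hc' : c.reverse ≠ Cycle.nil := fun h => hc (by rw [← c.reverse_reverse, h]; rfl)
  have hch' := hch.reverse
  refine ⟨walk c.reverse hc' hch' fun m k h =>
    (Cycle.nodup_reverse_iff.2 hn).eq_one_of_eq_flatten_replicate hc' h, ?_,
    fun e he => hmem e (Cycle.mem_reverse_iff.1 he)⟩
  obtain ⟨N, ℓ, hN, -, hcl, -⟩ := hch'.exists_unroll hc'
  exact ⟨ℓ (0 : ℕ), by
    change _ ∈ c.reverse
    rw [hcl, Cycle.mem_coe_iff]
    exact List.mem_map_of_mem (List.mem_range.2 hN)⟩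

theorem exists_unroll {c : Cycle E} (hc : c ≠ Cycle.nil)
    (h : c.Chain fun e f => G.tgt e = G.src f) :
    ∃ (N : ℕ) (ℓ : ℤ → E), 0 < N ∧ (∀ i, ℓ (i + N) = ℓ i) ∧
      c = (((List.range N).map fun k : ℕ => ℓ k : List E) : Cycle E) ∧
      (∀ i, G.tgt (ℓ i) = G.src (ℓ (i + 1))) ∧ ∀ e, e ∈ c ↔ ∃ i, ℓ i = e := by
  obtain ⟨N, ℓ, hN, hper, hcl, hr⟩ := Cycle.Chain.exists_unroll hc h
  refine ⟨N, ℓ, hN, hper, hcl, hr, fun e => ?_⟩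
  rw [hcl, Cycle.mem_coe_iff, List.mem_map]
  constructor
  · rintro ⟨k, -, rfl⟩
    exact ⟨k, rfl⟩
  · rintro ⟨i, rfl⟩
    have hpos : (0 : ℤ) < N := by exact_mod_cast hN
    have h1 := Int.emod_nonneg i hpos.ne'
    have h2 := Int.emod_lt_of_pos i hpos
    refine ⟨(i % N).toNat, List.mem_range.2 (by omega), ?_⟩
    rw [Int.toNat_of_nonneg h1]
    have hp : Function.Periodic ℓ (N : ℤ) := hper
    have h3 := (hp.int_mul (i / N)) (i % N)
    rw [← h3, Int.cast_id, mul_comm, Int.emod_add_mul_ediv]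

theorem exists_succ {a : G.DirectedCycle} {e : E} (he : e ∈ a.edgeSet) :
    ∃ f ∈ a.edgeSet, G.tgt e = G.src f := by
  cases a with
  | free l => exact he.elim
  | walk c h1 h2 h3 =>
    obtain ⟨N, ℓ, -, -, -, hr, hmem⟩ := exists_unroll h1 h2
    obtain ⟨i, rfl⟩ := (hmem e).1 he
    exact ⟨ℓ (i + 1), (hmem _).2 ⟨_, rfl⟩, hr i⟩

theorem exists_pred {a : G.DirectedCycle} {e : E} (he : e ∈ a.edgeSet) :
    ∃ f ∈ a.edgeSet, G.tgt f = G.src e := by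
  cases a with
  | free l => exact he.elim
  | walk c h1 h2 h3 =>
    obtain ⟨N, ℓ, -, -, -, hr, hmem⟩ := exists_unroll h1 h2
    obtain ⟨i, rfl⟩ := (hmem e).1 he
    exact ⟨ℓ (i - 1), (hmem _).2 ⟨_, rfl⟩, by rw [hr, sub_add_cancel]⟩

theorem induction_edgeSet {a : G.DirectedCycle} {P : E → Prop}
    (hP : ∀ e ∈ a.edgeSet, ∀ f ∈ a.edgeSet, G.tgt e = G.src f → P e → P f) {e f : E}
    (he : e ∈ a.edgeSet) (hf : f ∈ a.edgeSet) (h : P e) : P f := by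
  cases a with
  | free l => exact he.elim
  | walk c h1 h2 h3 =>
    obtain ⟨N, ℓ, hN, hper, -, hr, hmem⟩ := exists_unroll h1 h2
    obtain ⟨i, rfl⟩ := (hmem e).1 he
    obtain ⟨j, rfl⟩ := (hmem f).1 hf
    have hstep : ∀ k : ℕ, P (ℓ (i + k)) := fun k => by
      induction k with
      | zero => simpa using h
      | succ k ih =>
        refine hP (ℓ (i + k)) ((hmem _).2 ⟨_, rfl⟩) _ ((hmem _).2 ⟨_, rfl⟩) ?_ ih
        rw [hr]
        push_cast
        rw [add_assoc]
    have hp : Function.Periodic ℓ (N : ℤ) := hper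
    have hpos : (1 : ℤ) ≤ N := by exact_mod_cast hN
    have h3 := (hp.int_mul (|i - j|)) j
    rw [← h3, Int.cast_id]
    -- Adding `|i - j|` periods places `j` at or after `i`, where forward steps reach it.
    have h4 : 0 ≤ j + |i - j| * N - i := by
      nlinarith [le_abs_self (i - j), abs_nonneg (i - j)]
    have := hstep (j + |i - j| * N - i).toNat
    rwa [Int.toNat_of_nonneg h4, add_sub_cancel] at this

theorem isMergeLoop_of_mem (hG : G.IsAnnularStrandDiagram) (hred : G.IsReduced)
    {a : G.DirectedCycle} {e : E} (he : e ∈ a.edgeSet) (h : G.IsMerge (G.src e)) :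
    a.IsMergeLoop := by
  have key : ∀ f ∈ a.edgeSet, G.IsMerge (G.src f) := fun f hf =>
    induction_edgeSet (P := fun f => G.IsMerge (G.src f))
      (fun e _ f _ hef h => hef ▸ hG.isMerge_tgt hred h) he hf h
  cases a with
  | free l => exact he.elim
  | walk c h1 h2 h3 => exact key

theorem isSplitLoop_of_mem (hG : G.IsAnnularStrandDiagram) (hred : G.IsReduced)
    {a : G.DirectedCycle} {e : E} (he : e ∈ a.edgeSet) (h : G.IsSplit (G.src e)) :
    a.IsSplitLoop := by
  have key : ∀ f ∈ a.edgeSet, G.IsSplit (G.src f) := fun f hf =>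
    (hG.split_or_merge _).resolve_right fun hm =>
      h.not_isMerge (induction_edgeSet (P := fun f => G.IsMerge (G.src f))
        (fun e _ f _ hef h => hef ▸ hG.isMerge_tgt hred h) hf he hm)
  cases a with
  | free l => exact he.elim
  | walk c h1 h2 h3 => exact key

theorem IsMergeLoop.isMerge {a : G.DirectedCycle} (h : a.IsMergeLoop) {e : E}
    (he : e ∈ a.edgeSet) : G.IsMerge (G.src e) := by
  cases a with
  | free l => exact he.elim
  | walk c h1 h2 h3 => exact h e he

theorem IsSplitLoop.isSplit {a : G.DirectedCycle} (h : a.IsSplitLoop) {e : E}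
    (he : e ∈ a.edgeSet) : G.IsSplit (G.src e) := by
  cases a with
  | free l => exact he.elim
  | walk c h1 h2 h3 => exact h e he

theorem isMergeLoop_or_isSplitLoop (hG : G.IsAnnularStrandDiagram) (hred : G.IsReduced)
    {a : G.DirectedCycle} (ha : a.edgeSet.Nonempty) : a.IsMergeLoop ∨ a.IsSplitLoop := by
  obtain ⟨e, he⟩ := ha
  rcases hG.split_or_merge (G.src e) with h | h
  · exact Or.inr (isSplitLoop_of_mem hG hred he h)
  · exact Or.inl (isMergeLoop_of_mem hG hred he h)

/-- A merge loop is the orbit of any of its edges under the successor function, and a split loop is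
the reverse of the orbit of any of its edges under the predecessor function. -/
theorem exists_eq_periodicOrbit (hG : G.IsAnnularStrandDiagram) :
    (∃ next : E → E, ∀ c h1 h2 h3, (walk c h1 h2 h3 : G.DirectedCycle).IsMergeLoop → ∀ e ∈ c,
      e ∈ Function.periodicPts next ∧ c = Function.periodicOrbit next e) ∧
    ∃ prev : E → E, ∀ c h1 h2 h3, (walk c h1 h2 h3 : G.DirectedCycle).IsSplitLoop → ∀ e ∈ c,
      e ∈ Function.periodicPts prev ∧ c.reverse = Function.periodicOrbit prev e := by
  choose out hout using hG.exists_src_eq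
  choose inn hinn using hG.exists_tgt_eq
  refine ⟨⟨fun e => out (G.tgt e), fun c h1 h2 h3 hm e he => ?_⟩,
    ⟨fun e => inn (G.src e), fun c h1 h2 h3 hs e he => ?_⟩⟩
  · refine Cycle.Chain.eq_periodicOrbit h1 ?_ h3 he
    obtain ⟨N, ℓ, hN, hper, hcl, hr, hmem⟩ := exists_unroll h1 h2
    have hnat : ∀ m : ℕ, ℓ (m + 1) = out (G.tgt (ℓ m)) := fun m =>
      (hm _ ((hmem _).2 ⟨_, rfl⟩)).eq_of_src rfl (by rw [hout, hr])
    obtain ⟨n, rfl⟩ := Nat.exists_eq_succ_of_ne_zero hN.ne'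
    rw [hcl, ← Cycle.map_coe, Cycle.chain_map, Cycle.chain_range_succ]
    refine ⟨?_, fun m _ => by exact_mod_cast hnat m⟩
    rw [← hnat n, ← hper]
    simp
  · refine Cycle.Chain.eq_periodicOrbit
      (fun h => h1 (by rw [← c.reverse_reverse, h]; rfl)) ?_
      (fun m k h => h3 _ k (Cycle.reverse_eq_flatten_replicate h)) (Cycle.mem_reverse_iff.2 he)
    refine Cycle.Chain.reverse (r := fun x y => x = inn (G.src y)) ?_
    obtain ⟨N, ℓ, hN, hper, hcl, hr, hmem⟩ := exists_unroll h1 h2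
    have hnat : ∀ m : ℕ, ℓ m = inn (G.src (ℓ (m + 1))) := fun m =>
      (hs _ ((hmem _).2 ⟨_, rfl⟩)).eq_of_tgt (hr m) (hinn _)
    obtain ⟨n, rfl⟩ := Nat.exists_eq_succ_of_ne_zero hN.ne'
    rw [hcl, ← Cycle.map_coe, Cycle.chain_map, Cycle.chain_range_succ]
    refine ⟨?_, fun m _ => by exact_mod_cast hnat m⟩
    rw [hnat n]
    have := hper 0
    push_cast at this
    rw [zero_add] at this
    rw [this]
    rfl

/-- A minimal orbit repeats no edge. On a merge loop the source determines the edge. On a split loop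
equal sources force equal preceding edges, whose indices then agree modulo the length, and so do the
edges after them. -/
theorem isSimple (hG : G.IsAnnularStrandDiagram) (hred : G.IsReduced) (a : G.DirectedCycle) :
    a.IsSimple := by
  cases a with
  | free l => trivial
  | walk c h1 h2 h3 =>
    obtain ⟨⟨next, hnext⟩, ⟨prev, hprev⟩⟩ := exists_eq_periodicOrbit hG
    obtain ⟨N, ℓ, hN, hper, hcl, hr, hmem⟩ := exists_unroll h1 h2
    have h0 : ℓ 0 ∈ c := (hmem _).2 ⟨0, rfl⟩
    have hnodup : ∀ {c : Cycle E}, c.Nodup → (∀ e ∈ c, ∀ f ∈ c, G.src e = G.src f → e = f) →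
        (c.map G.src).Nodup := by
      intro c
      induction c using Quotient.inductionOn with
      | h l => exact fun hn hinj => List.Nodup.map_on (fun x hx y hy => hinj x hx y hy) hn
    rcases isMergeLoop_or_isSplitLoop hG hred (a := walk c h1 h2 h3) ⟨_, h0⟩ with h | h
    · have hc := (hnext c h1 h2 h3 h _ h0).2
      refine hnodup (hc ▸ Function.nodup_periodicOrbit) fun e he f hf hef => ?_
      exact (h e he).eq_of_src rfl hef.symm
    · have hc := (hprev c h1 h2 h3 h _ h0).2
      have hn : c.Nodup := Cycle.nodup_reverse_iff.1 (hc ▸ Function.nodup_periodicOrbit)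
      refine hnodup hn fun e he f hf hef => ?_
      obtain ⟨i, rfl⟩ := (hmem e).1 he
      obtain ⟨j, rfl⟩ := (hmem f).1 hf
      have hpred : ℓ (i - 1) = ℓ (j - 1) := (h _ he).eq_of_tgt
        (by rw [hr, sub_add_cancel]) (by rw [hr, sub_add_cancel, hef])
      obtain ⟨k, hk⟩ := List.Nodup.dvd_sub_of_periodic hN hper
        (by rwa [hcl, Cycle.nodup_coe_iff] at hn) hpred
      have hp := ((show Function.Periodic ℓ (N : ℤ) from hper).int_mul k) j
      rw [← hp, Int.cast_id]
      congr 1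
      linarith

/-- At a common split both cycles arrive by the single incoming edge, at a common merge both leave
by the single outgoing one. Either edge determines its cycle as an orbit. -/
theorem eq_of_src_eq (hG : G.IsAnnularStrandDiagram) (hred : G.IsReduced) {a b : G.DirectedCycle}
    {e f : E} (he : e ∈ a.edgeSet) (hf : f ∈ b.edgeSet) (hef : G.src e = G.src f) : a = b := by
  obtain ⟨⟨next, hnext⟩, ⟨prev, hprev⟩⟩ := exists_eq_periodicOrbit hG
  obtain ⟨e', he', hee'⟩ := exists_pred he
  obtain ⟨f', hf', hff'⟩ := exists_pred hf
  cases a with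
  | free l => exact he.elim
  | walk c h1 h2 h3 =>
  cases b with
  | free l => exact hf.elim
  | walk d k1 k2 k3 =>
    suffices h : c = d by
      subst h
      rfl
    rcases hG.split_or_merge (G.src e) with h | h
    · have ha := isSplitLoop_of_mem hG hred he h
      have hb := isSplitLoop_of_mem hG hred hf (hef ▸ h)
      have e1 := (hprev c h1 h2 h3 ha e' he').2
      have e2 := (hprev d k1 k2 k3 hb f' hf').2
      rw [h.eq_of_tgt hee' (hff'.trans hef.symm), ← e2] at e1
      rw [← c.reverse_reverse, e1, Cycle.reverse_reverse]
    · have ha := isMergeLoop_of_mem hG hred he h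
      have hb := isMergeLoop_of_mem hG hred hf (hef ▸ h)
      have e1 := (hnext c h1 h2 h3 ha e he).2
      have e2 := (hnext d k1 k2 k3 hb f hf).2
      rw [h.eq_of_src rfl hef.symm, ← e2] at e1
      exact e1

/-- The half-open interval suffices because the end of an edge is the start of its successor on the
cycle. -/
theorem mem_trace_iff {a : G.DirectedCycle} {z : ℂ} : z ∈ a.trace ↔
    (∃ e ∈ a.edgeSet, ∃ s ∈ Ico (0 : ℝ) 1, G.edge e s = z) ∨
      ∃ l s, a = free l ∧ G.loop l s = z := by
  cases a with
  | free l => simp [trace, edgeSet]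
  | walk c h1 h2 h3 =>
    simp only [trace, mem_iUnion, reduceCtorEq, false_and, exists_false, or_false]
    constructor
    · rintro ⟨e, he, s, hs, rfl⟩
      rcases hs.2.lt_or_eq with h | rfl
      · exact ⟨e, he, s, ⟨hs.1, h⟩, rfl⟩
      · obtain ⟨f, hf, hef⟩ := exists_succ (a := walk c h1 h2 h3) he
        exact ⟨f, hf, 0, by simp, by rw [G.edge_zero, G.edge_one, hef]⟩
    · rintro ⟨e, he, s, hs, rfl⟩
      exact ⟨e, he, s, ⟨hs.1, hs.2.le⟩, rfl⟩

theorem pos_mem_trace_iff {a : G.DirectedCycle} {v : V} :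
    G.pos v ∈ a.trace ↔ ∃ e ∈ a.edgeSet, G.src e = v := by
  rw [mem_trace_iff]
  constructor
  · rintro (⟨e, he, s, hs, hsv⟩ | ⟨l, s, -, hsv⟩)
    · rcases hs.1.eq_or_lt with rfl | h
      · rw [G.edge_zero] at hsv
        exact ⟨e, he, G.pos_injective hsv⟩
      · exact absurd hsv (G.edge_ne_pos e v s ⟨h, hs.2⟩)
    · exact absurd hsv (G.loop_ne_pos l v s)
  · rintro ⟨e, he, rfl⟩
    exact Or.inl ⟨e, he, 0, by simp, G.edge_zero e⟩

theorem edge_mem_trace_iff {a : G.DirectedCycle} {e : E} {s : ℝ} (hs : s ∈ Ioo (0 : ℝ) 1) :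
    G.edge e s ∈ a.trace ↔ e ∈ a.edgeSet := by
  rw [mem_trace_iff]
  constructor
  · rintro (⟨f, hf, t, ht, h⟩ | ⟨l, t, -, h⟩)
    · rcases ht.1.eq_or_lt with rfl | h'
      · rw [G.edge_zero] at h
        exact absurd h.symm (G.edge_ne_pos e _ s hs)
      · rwa [(G.edge_inj e f s hs t ⟨h', ht.2⟩ h.symm).1]
    · exact absurd h (G.loop_ne_edge l e t s (Ioo_subset_Icc_self hs))
  · exact fun he => Or.inl ⟨e, he, s, Ioo_subset_Ico_self hs, rfl⟩

theorem loop_inj' {l m : L} {s t : ℝ} (h : G.loop l s = G.loop m t) :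
    l = m ∧ ∃ k : ℤ, s - t = k * (1 : ℝ) := by
  have hfract : ∀ l s, G.loop l (Int.fract s) = G.loop l s := fun l s => by
    have := (G.loop_periodic l).sub_int_mul_eq ⌊s⌋ (x := s)
    rwa [mul_one] at this
  rw [← hfract l, ← hfract m] at h
  obtain ⟨h1, h2⟩ := G.loop_inj l m _ ⟨Int.fract_nonneg s, Int.fract_lt_one s⟩ _
    ⟨Int.fract_nonneg t, Int.fract_lt_one t⟩ h
  obtain ⟨k, hk⟩ := Int.fract_eq_fract.1 h2
  exact ⟨h1, k, by rw [hk, mul_one]⟩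

theorem disjoint_trace (hG : G.IsAnnularStrandDiagram) (hred : G.IsReduced)
    {a b : G.DirectedCycle} (hab : a ≠ b) : Disjoint a.trace b.trace := by
  rw [disjoint_left]
  intro z ha hb
  rcases mem_trace_iff.1 ha with ⟨e, he, s, hs, rfl⟩ | ⟨l, s, rfl, rfl⟩
  · rcases hs.1.eq_or_lt with rfl | h
    · rw [G.edge_zero] at hb
      obtain ⟨f, hf, hfe⟩ := pos_mem_trace_iff.1 hb
      exact hab (eq_of_src_eq hG hred he hf hfe.symm)
    · exact hab (eq_of_src_eq hG hred he ((edge_mem_trace_iff ⟨h, hs.2⟩).1 hb) rfl)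
  · rcases mem_trace_iff.1 hb with ⟨e, he, t, ht, h⟩ | ⟨m, t, rfl, h⟩
    · exact G.loop_ne_edge l e s t (Ico_subset_Icc_self ht) h.symm
    · exact hab (by rw [(loop_inj' h).1])

theorem edgeSet_nonempty_or (a : G.DirectedCycle) : a.edgeSet.Nonempty ∨ ∃ l, a = free l := by
  cases a with
  | free l => exact Or.inr ⟨l, rfl⟩
  | walk c h1 h2 h3 =>
    obtain ⟨N, ℓ, -, -, -, -, hmem⟩ := exists_unroll h1 h2
    exact Or.inl ⟨ℓ 0, (hmem _).2 ⟨0, rfl⟩⟩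

/-- A cycle with vertices can be recovered from any one of its edges, so cycles inject into `E ⊕ L`.
-/
theorem finite [Finite E] [Finite L] (hG : G.IsAnnularStrandDiagram) (hred : G.IsReduced) :
    Finite G.DirectedCycle := by
  have h : ∀ a : G.DirectedCycle, ∃ x : E ⊕ L,
      (∃ e ∈ a.edgeSet, x = Sum.inl e) ∨ ∃ l, a = free l ∧ x = Sum.inr l := fun a => by
    rcases a.edgeSet_nonempty_or with ⟨e, he⟩ | ⟨l, rfl⟩
    · exact ⟨_, Or.inl ⟨e, he, rfl⟩⟩
    · exact ⟨_, Or.inr ⟨l, rfl, rfl⟩⟩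
  choose f hf using h
  refine Finite.of_injective f fun a b hab => ?_
  rcases hf a with ⟨e, he, h1⟩ | ⟨l, rfl, h1⟩ <;> rcases hf b with ⟨e', he', h2⟩ | ⟨l', rfl, h2⟩ <;>
    rw [h1, h2] at hab
  · rw [Sum.inl.inj hab] at he
    exact eq_of_src_eq hG hred he he' rfl
  · cases hab
  · cases hab
  · rw [Sum.inr.inj hab]

end DirectedCycle

end AnnularGraph

/-! ### Directed cycles as simple closed curves. -/

theorem hasAngleChange_iff {γ : ℝ → ℂ} {p : ℂ} {θ : ℝ} : HasAngleChange γ p θ ↔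
    ∃ φ : ℝ → ℝ, IsAngleOn φ (fun t => γ t - p) (Icc 0 1) ∧ φ 1 - φ 0 = θ := by
  constructor
  · rintro ⟨hne, φ, hφ, hpolar, hθ⟩
    exact ⟨φ, ⟨hφ, fun t ht => ⟨sub_ne_zero.2 (hne t ht), hpolar t ht⟩⟩, hθ⟩
  · rintro ⟨φ, hφ, hθ⟩
    exact ⟨fun t ht => sub_ne_zero.1 (hφ.2 t ht).1, φ, hφ.1, fun t ht => (hφ.2 t ht).2, hθ⟩

theorem HasAngleChange.unique {γ : ℝ → ℂ} {p : ℂ} {θ θ' : ℝ} (h : HasAngleChange γ p θ)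
    (h' : HasAngleChange γ p θ') : θ = θ' := by
  obtain ⟨φ, hφ, rfl⟩ := hasAngleChange_iff.1 h
  obtain ⟨ψ, hψ, rfl⟩ := hasAngleChange_iff.1 h'
  exact IsAngleOn.sub_eq_sub isPreconnected_Icc hφ hψ (by simp) (by simp)

namespace AnnularGraph

variable {V E L : Type*} {G : AnnularGraph V E L}

namespace DirectedCycle

/-- `γ` is a simple closed curve of period `N` running through the cycle `a`. -/
structure Parametrizes (γ : ℝ → ℂ) (N : ℝ) (a : G.DirectedCycle) : Prop where
  continuous : Continuous γ
  pos : 0 < N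
  periodic : Function.Periodic γ N
  inj : ∀ s t, γ s = γ t → ∃ k : ℤ, s - t = k * N
  range_eq : range γ = a.trace
  hasWinding_iff : ∀ p w, a.HasWinding p w ↔ WindsAround γ N p w
  norm_mem : ∀ t, 1 < ‖γ t‖ ∧ ‖γ t‖ < 2
  crossing : ∀ σ, G.IsCuttingPath σ → ∀ t ∈ Icc (0 : ℝ) 1, ∀ s, σ t = γ s →
    PositiveCrossing σ t γ s

theorem parametrizes_free (l : L) :
    Parametrizes (G.loop l) 1 (free l : G.DirectedCycle) where
  continuous := G.loop_continuous l
  pos := one_pos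
  periodic := G.loop_periodic l
  inj s t h := (loop_inj' h).2
  range_eq := rfl
  hasWinding_iff p w := by
    refine (hasAngleChange_iff (γ := G.loop l) (p := p) (θ := 2 * Real.pi * w)).trans ⟨?_, ?_⟩
    · rintro ⟨φ, hφ, hw⟩
      have hne : ∀ t, G.loop l t ≠ p := fun t => by
        obtain ⟨s, hs, hst⟩ := (G.loop_periodic l).exists_mem_Ico₀ one_pos t
        rw [hst]
        exact sub_ne_zero.1 (hφ.2 s (Ico_subset_Icc_self hs)).1
      obtain ⟨ψ, hψ⟩ := exists_isAngleOn_real ((G.loop_continuous l).sub continuous_const)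
        (fun t => sub_ne_zero.2 (hne t))
      refine ⟨ψ, hψ, ?_⟩
      rw [← hw]
      exact IsAngleOn.sub_eq_sub isPreconnected_Icc (hψ.mono (subset_univ _)) hφ
        (by simp) (by simp)
    · rintro ⟨φ, hφ, hw⟩
      exact ⟨φ, hφ.mono (subset_univ _), hw⟩
  norm_mem := G.loop_mem l
  crossing σ hσ t ht s h := hσ.cross_loop t ht l s h

/-- The concatenation of the edges `ℓ i`, the `i`-th one running over `[i, i + 1]`. -/
noncomputable def concatEdges (G : AnnularGraph V E L) (ℓ : ℤ → E) (x : ℝ) : ℂ :=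
  G.edge (ℓ ⌊x⌋) (Int.fract x)

section concatEdges

variable {ℓ : ℤ → E}

theorem concatEdges_of_mem (hr : ∀ i, G.tgt (ℓ i) = G.src (ℓ (i + 1)))
    {n : ℤ} {x : ℝ} (hx : x ∈ Icc (n : ℝ) (n + 1)) :
    concatEdges G ℓ x = G.edge (ℓ n) (x - n) := by
  rcases hx.2.lt_or_eq with h | rfl
  · have hfl : ⌊x⌋ = n := Int.floor_eq_iff.2 ⟨hx.1, h⟩
    rw [concatEdges, Int.fract, hfl]
  · rw [concatEdges, show (n : ℝ) + 1 = ((n + 1 : ℤ) : ℝ) by push_cast; ring, Int.floor_intCast,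
      Int.fract_intCast, G.edge_zero, ← hr]
    push_cast
    rw [add_sub_cancel_left, G.edge_one]

theorem continuous_concatEdges (hr : ∀ i, G.tgt (ℓ i) = G.src (ℓ (i + 1))) :
    Continuous (concatEdges G ℓ) := by
  have hcon : ∀ n : ℤ, ContinuousOn (concatEdges G ℓ) (Icc (n : ℝ) (n + 1)) := fun n => by
    refine ContinuousOn.congr ?_ fun x hx => concatEdges_of_mem hr hx
    exact (G.edge_continuousOn (ℓ n)).comp (by fun_prop)
      fun x hx => ⟨by linarith [hx.1], by linarith [hx.2]⟩
  refine continuous_iff_continuousAt.2 fun x => ?_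
  have h1 := (hcon (⌊x⌋ - 1)).union_of_isClosed (hcon ⌊x⌋) isClosed_Icc isClosed_Icc
  push_cast at h1
  rw [sub_add_cancel, Icc_union_Icc_eq_Icc (by linarith) (by linarith)] at h1
  exact h1.continuousAt (Icc_mem_nhds (by linarith [Int.floor_le x]) (Int.lt_floor_add_one x))

theorem hasAngleChange_of_concatEdges (hr : ∀ i, G.tgt (ℓ i) = G.src (ℓ (i + 1)))
    {p : ℂ} {φ : ℝ → ℝ}
    (hφ : IsAngleOn φ (fun t => concatEdges G ℓ t - p) univ) (i : ℤ) :
    HasAngleChange (G.edge (ℓ i)) p (φ (i + 1) - φ i) := by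
  rw [hasAngleChange_iff]
  refine ⟨fun t => φ (i + t), ((hφ.comp (u := fun t => (i : ℝ) + t) (by fun_prop)
    (mapsTo_univ _ univ)).mono (subset_univ _)).congr fun t ht => ?_, by simp⟩
  simp only [Function.comp]
  rw [concatEdges_of_mem hr (n := i) (x := i + t) ⟨by linarith [ht.1], by linarith [ht.2]⟩,
    add_sub_cancel_left]

theorem concatEdges_periodic {N : ℕ} (hper : ∀ i, ℓ (i + N) = ℓ i) :
    Function.Periodic (concatEdges G ℓ) N := fun x => by
  simp only [concatEdges]
  rw [Int.floor_add_natCast, hper, Int.fract_add_natCast]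

theorem concatEdges_inj {N : ℕ} (hN : 0 < N) (hper : ∀ i, ℓ (i + N) = ℓ i)
    (hn : ((List.range N).map fun k : ℕ => G.src (ℓ k)).Nodup) {s t : ℝ}
    (h : concatEdges G ℓ s = concatEdges G ℓ t) : ∃ k : ℤ, s - t = k * (N : ℝ) := by
  have key : G.src (ℓ ⌊s⌋) = G.src (ℓ ⌊t⌋) ∧ Int.fract s = Int.fract t := by
    have h1 := Int.fract_lt_one s
    have h2 := Int.fract_lt_one t
    simp only [concatEdges] at h
    rcases (Int.fract_nonneg s).eq_or_lt with hs | hs <;>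
      rcases (Int.fract_nonneg t).eq_or_lt with ht | ht
    · rw [← hs, ← ht, G.edge_zero, G.edge_zero] at h
      exact ⟨G.pos_injective h, by rw [← hs, ← ht]⟩
    · rw [← hs, G.edge_zero] at h
      exact absurd h.symm (G.edge_ne_pos _ _ _ ⟨ht, h2⟩)
    · rw [← ht, G.edge_zero] at h
      exact absurd h (G.edge_ne_pos _ _ _ ⟨hs, h1⟩)
    · obtain ⟨h3, h4⟩ := G.edge_inj _ _ _ ⟨hs, h1⟩ _ ⟨ht, h2⟩ h
      exact ⟨by rw [h3], h4⟩
  obtain ⟨k, hk⟩ := List.Nodup.dvd_sub_of_periodic hN (ℓ := fun i => G.src (ℓ i))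
    (fun i => by simp only [hper]) hn key.1
  refine ⟨k, ?_⟩
  have hk' : (⌊s⌋ : ℝ) - ⌊t⌋ = N * k := by exact_mod_cast hk
  have h2 := key.2
  rw [Int.fract, Int.fract] at h2
  linarith

theorem positiveCrossing_concatEdges (hr : ∀ i, G.tgt (ℓ i) = G.src (ℓ (i + 1)))
    {σ : ℝ → ℂ} (hσ : G.IsCuttingPath σ) {t : ℝ} (ht : t ∈ Icc (0 : ℝ) 1) {s : ℝ} (h : σ t = concatEdges G ℓ s) :
    PositiveCrossing σ t (concatEdges G ℓ) s := by
  have hs : Int.fract s ∈ Ioo (0 : ℝ) 1 := by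
    refine ⟨lt_of_le_of_ne (Int.fract_nonneg s) fun h0 => ?_, Int.fract_lt_one s⟩
    rw [concatEdges, ← h0, G.edge_zero] at h
    exact hσ.ne_pos t ht _ h
  obtain ⟨u, v, hu, hv, huv⟩ := hσ.cross_edge t ht (ℓ ⌊s⌋) _ hs h
  refine ⟨u, v, hu, ?_, huv⟩
  have h1 : HasDerivAt (fun x => G.edge (ℓ ⌊s⌋) (x - ⌊s⌋)) v s := by
    rw [Int.fract] at hv
    exact hv.comp_sub_const s (⌊s⌋ : ℝ)
  refine h1.congr_of_eventuallyEq ?_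
  have hs1 : (⌊s⌋ : ℝ) < s := by
    have := hs.1
    rw [Int.fract] at this
    linarith
  filter_upwards [Icc_mem_nhds hs1 (Int.lt_floor_add_one s)] with x hx
  exact concatEdges_of_mem hr hx

end concatEdges

theorem exists_parametrizes {a : G.DirectedCycle} (ha : a.IsSimple) :
    ∃ γ N, Parametrizes γ N a := by
  cases a with
  | free l => exact ⟨_, _, parametrizes_free l⟩
  | walk c h1 h2 h3 =>
    obtain ⟨N, ℓ, hN, hper, hcl, hr, hmem⟩ := exists_unroll h1 h2
    have hn : ((List.range N).map fun k : ℕ => G.src (ℓ k)).Nodup := by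
      have : (c.map G.src).Nodup := ha
      rw [hcl, Cycle.map_coe, Cycle.nodup_coe_iff, List.map_map] at this
      exact this
    have hrange : range (concatEdges G ℓ) = ⋃ e ∈ c, G.edge e '' Icc 0 1 := by
      ext z
      simp only [mem_range, mem_iUnion, mem_image]
      constructor
      · rintro ⟨x, rfl⟩
        exact ⟨ℓ ⌊x⌋, (hmem _).2 ⟨_, rfl⟩, Int.fract x,
          ⟨Int.fract_nonneg x, (Int.fract_lt_one x).le⟩, rfl⟩
      · rintro ⟨e, he, s, hs, rfl⟩
        obtain ⟨i, rfl⟩ := (hmem e).1 he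
        refine ⟨i + s, ?_⟩
        rw [concatEdges_of_mem hr (n := i) ⟨by linarith [hs.1], by linarith [hs.2]⟩,
          add_sub_cancel_left]
    have hcont := continuous_concatEdges hr
    -- The angle changes of the single edges telescope over one period.
    have hsum : ∀ (φ : ℝ → ℝ) (θ : E → ℝ), (∀ i : ℤ, θ (ℓ i) = φ (i + 1) - φ i) →
        (c.toMultiset.map θ).sum = φ N - φ 0 := by
      intro φ θ hθ
      rw [hcl, Cycle.coe_toMultiset, Multiset.map_coe, Multiset.sum_coe, List.map_map]
      clear hn hcl hper hN
      induction N with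
      | zero => simp
      | succ n ih =>
        rw [List.range_succ, List.map_append, List.sum_append, ih]
        simp [hθ]
    refine ⟨concatEdges G ℓ, N, hcont, by exact_mod_cast hN, concatEdges_periodic hper,
      fun s t => concatEdges_inj hN hper hn, hrange, fun p w => ⟨?_, ?_⟩, fun t => ?_,
      fun σ hσ t ht s h => positiveCrossing_concatEdges hr hσ ht h⟩
    · rintro ⟨θ, hθ, hw⟩
      have hne : ∀ t, concatEdges G ℓ t ≠ p := fun t =>
        (hθ (ℓ ⌊t⌋) ((hmem _).2 ⟨_, rfl⟩)).1 _ ⟨Int.fract_nonneg t, (Int.fract_lt_one t).le⟩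
      obtain ⟨φ, hφ⟩ := exists_isAngleOn_real (hcont.sub continuous_const)
        (fun t => sub_ne_zero.2 (hne t))
      refine ⟨φ, hφ, ?_⟩
      rw [← hw, hsum φ θ fun i => ?_]
      exact (hθ _ ((hmem _).2 ⟨i, rfl⟩)).unique (hasAngleChange_of_concatEdges hr hφ i)
    · rintro ⟨φ, hφ, hw⟩
      have hex : ∀ e, ∃ θ, e ∈ c → HasAngleChange (G.edge e) p θ := fun e => by
        by_cases he : e ∈ c
        · obtain ⟨i, rfl⟩ := (hmem e).1 he
          exact ⟨_, fun _ => hasAngleChange_of_concatEdges hr hφ i⟩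
        · exact ⟨0, fun h => absurd h he⟩
      choose θ hθ using hex
      refine ⟨θ, hθ, ?_⟩
      rw [← hw, hsum φ θ fun i => ?_]
      exact (hθ _ ((hmem _).2 ⟨i, rfl⟩)).unique (hasAngleChange_of_concatEdges hr hφ i)
    · exact G.edge_mem _ _ ⟨Int.fract_nonneg t, (Int.fract_lt_one t).le⟩

end DirectedCycle

end AnnularGraph

/-! ### Nesting order and the cycles of a component. -/

theorem exists_list_pairwise_lt {α : Type*} [Finite α] {f : α → ℝ} (hf : Function.Injective f)
    (P : α → Prop) : ∃ C : List α, (∀ a, a ∈ C ↔ P a) ∧ C.Pairwise fun a b => f a < f b := by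
  classical
  have := Fintype.ofFinite α
  let _ : LinearOrder α := LinearOrder.lift' f hf
  refine ⟨(Finset.univ.filter P).sort, fun a => by simp, ?_⟩
  exact (Finset.sortedLT_sort _).pairwise

theorem List.Pairwise.isChain_of_forall_adjacent {α : Type*} {f : α → ℝ} {Q : α → α → Prop}
    {C : List α} (hC : C.Pairwise fun a b => f a < f b)
    (h : ∀ a ∈ C, ∀ b ∈ C, f a < f b → (∀ c ∈ C, ¬ (f a < f c ∧ f c < f b)) → Q a b) :
    C.IsChain Q := by
  rw [List.pairwise_iff_getElem] at hC
  have hlt : ∀ i j (hi : i < C.length) (hj : j < C.length), f C[i] < f C[j] → i < j := by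
    intro i j hi hj hij
    by_contra! hji
    rcases hji.eq_or_lt with rfl | hji
    · exact lt_irrefl _ hij
    · exact lt_asymm hij (hC j i hj hi hji)
  rw [List.isChain_iff_getElem]
  intro i hi
  refine h _ (List.getElem_mem _) _ (List.getElem_mem _) (hC i (i + 1) _ _ (by omega)) ?_
  rintro c hc ⟨h1, h2⟩
  obtain ⟨j, hj, rfl⟩ := List.getElem_of_mem hc
  have h3 := hlt _ _ _ _ h1
  have h4 := hlt _ _ _ _ h2
  omega

namespace AnnularGraph

variable {V E L : Type*} {G : AnnularGraph V E L}

namespace DirectedCycle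

theorem HasWinding.notMem_trace {a : G.DirectedCycle} (ha : a.IsSimple) {p : ℂ} {w : ℤ}
    (hw : a.HasWinding p w) : p ∉ a.trace := by
  obtain ⟨γ, N, h⟩ := exists_parametrizes ha
  rw [← h.range_eq]
  rintro ⟨t, ht⟩
  exact ((h.hasWinding_iff p w).1 hw).ne t ht

theorem HasWinding.unique {a : G.DirectedCycle} (ha : a.IsSimple) {p : ℂ} {w w' : ℤ}
    (hw : a.HasWinding p w) (hw' : a.HasWinding p w') : w = w' := by
  obtain ⟨γ, N, h⟩ := exists_parametrizes ha
  exact ((h.hasWinding_iff p w).1 hw).unique ((h.hasWinding_iff p w').1 hw')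

theorem HasWinding.of_isPreconnected {a : G.DirectedCycle} (ha : a.IsSimple) {S : Set ℂ}
    (hS : IsPreconnected S) (hdisj : Disjoint S a.trace) {p q : ℂ} (hp : p ∈ S) (hq : q ∈ S)
    {w : ℤ} (hw : a.HasWinding p w) : a.HasWinding q w := by
  obtain ⟨γ, N, h⟩ := exists_parametrizes ha
  rw [h.hasWinding_iff] at hw ⊢
  exact WindsAround.of_isPreconnected h.continuous h.pos h.periodic hS (h.range_eq ▸ hdisj) hp hq hw

theorem hasWinding_zero_one (hG : G.IsAnnularStrandDiagram) {a : G.DirectedCycle}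
    (ha : a.IsSimple) : a.HasWinding 0 1 := by
  obtain ⟨γ, N, h⟩ := exists_parametrizes ha
  obtain ⟨w, hw, haw⟩ := hG.winding_pos a
  have h1 := WindsAround.le_one_of_injective h.continuous h.pos h.periodic h.inj
    ((h.hasWinding_iff 0 w).1 haw)
  rwa [show w = 1 by omega] at haw

theorem existsUnique_meet (hG : G.IsAnnularStrandDiagram) {a : G.DirectedCycle}
    (ha : a.IsSimple) {σ : ℝ → ℂ} (hσ : G.IsCuttingPath σ) :
    ∃! t, t ∈ Icc (0 : ℝ) 1 ∧ σ t ∈ a.trace := by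
  obtain ⟨γ, N, h⟩ := exists_parametrizes ha
  rw [← h.range_eq]
  exact WindsAround.existsUnique_crossing h.continuous h.pos h.periodic h.inj
    ((h.hasWinding_iff 0 1).1 (hasWinding_zero_one hG ha)) h.norm_mem hσ.continuousOn hσ.start
    hσ.finish (h.crossing σ hσ)

theorem Inside.lt_of_meet (hG : G.IsAnnularStrandDiagram) {a b : G.DirectedCycle}
    (hb : b.IsSimple) (hab : a.Inside b) {σ : ℝ → ℂ} (hσ : G.IsCuttingPath σ) {s t : ℝ}
    (hs : s ∈ Icc (0 : ℝ) 1) (ht : t ∈ Icc (0 : ℝ) 1) (hsa : σ s ∈ a.trace)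
    (htb : σ t ∈ b.trace) : s < t := by
  obtain ⟨γ, N, h⟩ := exists_parametrizes hb
  exact WindsAround.crossing_lt h.continuous h.pos h.periodic h.inj
    ((h.hasWinding_iff 0 1).1 (hasWinding_zero_one hG hb)) h.norm_mem hσ.continuousOn hσ.start
    hσ.finish (h.crossing σ hσ) hs ht ((h.hasWinding_iff _ 1).1 (hab _ hsa)) (h.range_eq ▸ htb)

/-- The largest distance of a point of the cycle from the origin. -/
noncomputable def radius (a : G.DirectedCycle) : ℝ :=
  sSup ((fun z : ℂ => ‖z‖) '' a.trace)

/-- Makes `radius` a numerical measure of nesting: among distinct cycles, comparing maximal moduli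
decides which encloses which. -/
theorem inside_of_radius_le (hG : G.IsAnnularStrandDiagram) (hred : G.IsReduced)
    {a b : G.DirectedCycle} (hab : a ≠ b) (hle : a.radius ≤ b.radius) :
    a.Inside b ∧ ∀ p ∈ b.trace, a.HasWinding p 0 := by
  have ha := isSimple hG hred a
  have hb := isSimple hG hred b
  obtain ⟨γ, N, h⟩ := exists_parametrizes ha
  obtain ⟨γ', N', h'⟩ := exists_parametrizes hb
  have hdisj := disjoint_trace hG hred hab
  rw [← h.range_eq, ← h'.range_eq] at hdisj
  obtain ⟨h1, h2⟩ := WindsAround.of_forall_exists_norm_le h.continuous h.pos h.periodic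
    h'.continuous h'.pos h'.periodic ((h.hasWinding_iff 0 1).1 (hasWinding_zero_one hG ha))
    ((h'.hasWinding_iff 0 1).1 (hasWinding_zero_one hG hb)) hdisj fun s => by
      have hK := (isCompact_range_of_periodic h.continuous h.pos h.periodic).image continuous_norm
      have hK' := (isCompact_range_of_periodic h'.continuous h'.pos h'.periodic).image
        continuous_norm
      obtain ⟨_, ⟨t, rfl⟩, ht⟩ := hK'.sSup_mem ((range_nonempty _).image _)
      refine ⟨t, ?_⟩
      rw [radius, radius, ← h.range_eq, ← h'.range_eq] at hle
      exact (le_csSup hK.bddAbove ⟨_, mem_range_self s, rfl⟩).trans (hle.trans ht.ge)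
  rw [Inside, ← h.range_eq, ← h'.range_eq]
  refine ⟨?_, ?_⟩
  · rintro _ ⟨s, rfl⟩
    exact (h'.hasWinding_iff _ _).2 (h1 s)
  · rintro _ ⟨t, rfl⟩
    exact (h.hasWinding_iff _ _).2 (h2 t)

theorem trace_nonempty (a : G.DirectedCycle) : a.trace.Nonempty := by
  rcases a.edgeSet_nonempty_or with ⟨e, he⟩ | ⟨l, rfl⟩
  · exact ⟨_, pos_mem_trace_iff.2 ⟨e, he, rfl⟩⟩
  · exact range_nonempty _

/-- Distinct cycles of equal radius would each enclose the other. -/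
theorem radius_injective (hG : G.IsAnnularStrandDiagram) (hred : G.IsReduced) :
    Function.Injective (radius : G.DirectedCycle → ℝ) := by
  intro a b hr
  by_contra hab
  obtain ⟨p, hp⟩ := a.trace_nonempty
  exact one_ne_zero (((inside_of_radius_le hG hred hab hr.le).1 p hp).unique (isSimple hG hred b)
    ((inside_of_radius_le hG hred (Ne.symm hab) hr.ge).2 p hp))

theorem radius_lt_of_hasWinding_one (hG : G.IsAnnularStrandDiagram) (hred : G.IsReduced)
    {a b : G.DirectedCycle} {p : ℂ} (hp : p ∈ a.trace) (h : b.HasWinding p 1) :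
    a.radius < b.radius := by
  have hb := isSimple hG hred b
  have hab : b ≠ a := by
    rintro rfl
    exact h.notMem_trace hb hp
  by_contra! hle
  exact one_ne_zero (h.unique hb ((inside_of_radius_le hG hred hab hle).2 p hp))

theorem radius_lt_of_hasWinding_zero (hG : G.IsAnnularStrandDiagram) (hred : G.IsReduced)
    {a b : G.DirectedCycle} {p : ℂ} (hp : p ∈ b.trace) (h : a.HasWinding p 0) :
    a.radius < b.radius := by
  have ha := isSimple hG hred a
  have hab : b ≠ a := by
    rintro rfl
    exact h.notMem_trace ha hp
  by_contra! hle
  exact zero_ne_one (h.unique ha ((inside_of_radius_le hG hred hab hle).1 p hp))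

theorem liesIn_iff {a : G.DirectedCycle} {K : G.Component} : a.LiesIn K ↔
    (∀ e ∈ a.edgeSet, Sum.inl (Quot.mk _ (G.src e)) = K) ∧ ∀ l, a = free l → Sum.inr l = K := by
  cases a with
  | walk c h1 h2 h3 => simp [LiesIn, edgeSet]
  | free l => simp [LiesIn, edgeSet]

theorem liesIn_of_edgeSet {a : G.DirectedCycle} (ha : a.edgeSet.Nonempty) {K : G.Component}
    (h : ∀ e ∈ a.edgeSet, Sum.inl (Quot.mk _ (G.src e)) = K) : a.LiesIn K := by
  refine liesIn_iff.2 ⟨h, ?_⟩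
  rintro l rfl
  obtain ⟨e, he⟩ := ha
  exact he.elim

theorem edgeSet_nonempty_of_liesIn {a : G.DirectedCycle} {q}
    (h : a.LiesIn (Sum.inl q : G.Component)) : a.edgeSet.Nonempty := by
  rcases a.edgeSet_nonempty_or with h' | ⟨l, rfl⟩
  · exact h'
  · cases (liesIn_iff.1 h).2 l rfl

/-- An edge with both ends off the cycle avoids it entirely, and winding numbers are constant on
connected sets avoiding the curve. -/
theorem hasWinding_src_iff {a : G.DirectedCycle} (ha : a.IsSimple) {e : E}
    (hs : G.pos (G.src e) ∉ a.trace) (ht : G.pos (G.tgt e) ∉ a.trace) {w : ℤ} :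
    a.HasWinding (G.pos (G.src e)) w ↔ a.HasWinding (G.pos (G.tgt e)) w := by
  have hpre : IsPreconnected (G.edge e '' Icc 0 1) :=
    isPreconnected_Icc.image _ (G.edge_continuousOn e)
  have hdisj : Disjoint (G.edge e '' Icc 0 1) a.trace := by
    rw [disjoint_left]
    rintro _ ⟨s, hs', rfl⟩ hmem
    rcases hs'.1.eq_or_lt with rfl | h0
    · exact hs (G.edge_zero e ▸ hmem)
    rcases hs'.2.eq_or_lt with rfl | h1
    · exact ht (G.edge_one e ▸ hmem)
    exact hs (pos_mem_trace_iff.2 ⟨e, (edge_mem_trace_iff ⟨h0, h1⟩).1 hmem, rfl⟩)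
  have h0 : G.pos (G.src e) ∈ G.edge e '' Icc 0 1 := ⟨0, by simp, G.edge_zero e⟩
  have h1 : G.pos (G.tgt e) ∈ G.edge e '' Icc 0 1 := ⟨1, by simp, G.edge_one e⟩
  exact ⟨HasWinding.of_isPreconnected ha hpre hdisj h0 h1,
    HasWinding.of_isPreconnected ha hpre hdisj h1 h0⟩

/-- A merge loop cannot be left along the arrows, because the only outgoing edge at each of its
vertices belongs to it. -/
theorem IsMergeLoop.tgt_mem {a : G.DirectedCycle} (ha : a.IsMergeLoop) {e : E}
    (h : G.pos (G.src e) ∈ a.trace) : G.pos (G.tgt e) ∈ a.trace := by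
  obtain ⟨f, hf, hfe⟩ := pos_mem_trace_iff.1 h
  have hef : f = e := (ha.isMerge hf).eq_of_src rfl hfe.symm
  obtain ⟨g, hg, hfg⟩ := exists_succ hf
  exact pos_mem_trace_iff.2 ⟨g, hg, by rw [← hfg, hef]⟩

theorem IsSplitLoop.src_mem {a : G.DirectedCycle} (ha : a.IsSplitLoop) {e : E}
    (h : G.pos (G.tgt e) ∈ a.trace) : G.pos (G.src e) ∈ a.trace := by
  obtain ⟨f, hf, hfe⟩ := pos_mem_trace_iff.1 h
  obtain ⟨g, hg, hgf⟩ := exists_pred hf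
  have heg : e = g := (ha.isSplit hf).eq_of_tgt hfe.symm hgf
  exact pos_mem_trace_iff.2 ⟨g, hg, by rw [heg]⟩

theorem _root_.AnnularGraph.exists_edge_of_mem_of_notMem {S : Set V} {u v : V}
    (huv : (Quot.mk _ u : Quot fun u v : V => ∃ e, G.src e = u ∧ G.tgt e = v) = Quot.mk _ v)
    (hu : u ∈ S) (hv : v ∉ S) :
    ∃ e, (G.src e ∈ S ∧ G.tgt e ∉ S) ∨ (G.src e ∉ S ∧ G.tgt e ∈ S) := by
  by_contra! h
  have hS : ∀ u v, (∃ e, G.src e = u ∧ G.tgt e = v) → (u ∈ S) = (v ∈ S) := by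
    rintro _ _ ⟨e, rfl, rfl⟩
    have := h e
    exact propext ⟨fun h1 => by tauto, fun h1 => by tauto⟩
  have := congrArg (Quot.lift (· ∈ S) hS) huv
  exact hv ((iff_of_eq this).1 hu)

/-- The vertices of a component between two of its cycles, neither of which can be left along an
edge from `s` to `t`: there are such vertices, and they are closed under passing from `t` to `s`. -/
theorem between_closed (hG : G.IsAnnularStrandDiagram) (hred : G.IsReduced)
    {a b : G.DirectedCycle} {q : Quot fun u v : V => ∃ e, G.src e = u ∧ G.tgt e = v}
    (ha : a.LiesIn (Sum.inl q)) (hb : b.LiesIn (Sum.inl q)) (hab : a.radius < b.radius)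
    {s t : E → V} (hst : (s = G.src ∧ t = G.tgt) ∨ (s = G.tgt ∧ t = G.src))
    (has : ∀ e, G.pos (s e) ∈ a.trace → G.pos (t e) ∈ a.trace)
    (hbs : ∀ e, G.pos (s e) ∈ b.trace → G.pos (t e) ∈ b.trace) {R : Set V}
    (hR : R = {v | Quot.mk _ v = q ∧ a.HasWinding (G.pos v) 0 ∧ b.HasWinding (G.pos v) 1}) :
    (∀ e, t e ∈ R → s e ∈ R) ∧ R.Nonempty := by
  have hsa := isSimple hG hred a
  have hsb := isSimple hG hred b
  have hne : a ≠ b := by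
    rintro rfl
    exact lt_irrefl _ hab
  obtain ⟨hin, hout⟩ := inside_of_radius_le hG hred hne hab.le
  have hdisj := disjoint_left.1 (disjoint_trace hG hred hne)
  have hmk : ∀ e, (Quot.mk _ (s e) : Quot fun u v : V => ∃ e, G.src e = u ∧ G.tgt e = v) =
      Quot.mk _ (t e) := by
    rcases hst with ⟨rfl, rfl⟩ | ⟨rfl, rfl⟩
    · exact fun e => Quot.sound ⟨e, rfl, rfl⟩
    · exact fun e => (Quot.sound ⟨e, rfl, rfl⟩).symm
  have hwind : ∀ {c : G.DirectedCycle}, c.IsSimple → ∀ e, G.pos (s e) ∉ c.trace →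
      G.pos (t e) ∉ c.trace → ∀ w, c.HasWinding (G.pos (s e)) w ↔ c.HasWinding (G.pos (t e)) w := by
    intro c hc e h1 h2 w
    rcases hst with ⟨rfl, rfl⟩ | ⟨rfl, rfl⟩
    · exact hasWinding_src_iff hc h1 h2
    · exact (hasWinding_src_iff hc h2 h1).symm
  subst hR
  refine ⟨?_, ?_⟩
  · rintro e ⟨h1, h2, h3⟩
    have h4 := h2.notMem_trace hsa
    have h5 := h3.notMem_trace hsb
    exact ⟨(hmk e).trans h1, (hwind hsa e (fun h => h4 (has e h)) h4 0).2 h2,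
      (hwind hsb e (fun h => h5 (hbs e h)) h5 1).2 h3⟩
  · obtain ⟨e₁, he₁⟩ := edgeSet_nonempty_of_liesIn ha
    obtain ⟨e₂, he₂⟩ := edgeSet_nonempty_of_liesIn hb
    have hq₁ := Sum.inl.inj ((liesIn_iff.1 ha).1 e₁ he₁)
    have hq₂ := Sum.inl.inj ((liesIn_iff.1 hb).1 e₂ he₂)
    -- Connectedness yields an edge with one end outside `a` and the other not. As `a` cannot be
    -- left from `s` to `t`, its `t`-end lies on `a`, hence inside `b`. Its `s`-end is then also
    -- inside `b`, since `b` cannot be left from `s` to `t` either.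
    have hS := exists_edge_of_mem_of_notMem (G := G) (hq₁.trans hq₂.symm)
      (S := {v | ¬ (Quot.mk _ v = q ∧ a.HasWinding (G.pos v) 0)})
      (fun h => h.2.notMem_trace hsa (pos_mem_trace_iff.2 ⟨e₁, he₁, rfl⟩))
      (fun h => h ⟨hq₂, hout _ (pos_mem_trace_iff.2 ⟨e₂, he₂, rfl⟩)⟩)
    have hS' : ∃ e, (¬ (Quot.mk _ (s e) = q ∧ a.HasWinding (G.pos (s e)) 0) ∧
        (Quot.mk _ (t e) = q ∧ a.HasWinding (G.pos (t e)) 0)) ∨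
        ((Quot.mk _ (s e) = q ∧ a.HasWinding (G.pos (s e)) 0) ∧
        ¬ (Quot.mk _ (t e) = q ∧ a.HasWinding (G.pos (t e)) 0)) := by
      obtain ⟨e, he⟩ := hS
      refine ⟨e, ?_⟩
      simp only [mem_ofPred_eq, not_not] at he
      rcases hst with ⟨rfl, rfl⟩ | ⟨rfl, rfl⟩ <;> tauto
    obtain ⟨e, ⟨h1, h2, h3⟩ | ⟨⟨h1, h2⟩, h3⟩⟩ := hS'
    · have h4 := h3.notMem_trace hsa
      exact absurd ⟨(hmk e).trans h2, (hwind hsa e (fun h => h4 (has e h)) h4 0).2 h3⟩ h1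
    · have h4 := h2.notMem_trace hsa
      have h5 : G.pos (t e) ∈ a.trace := by
        by_contra h5
        exact h3 ⟨(hmk e).symm.trans h1, (hwind hsa e h4 h5 0).1 h2⟩
      have h6 := hdisj h5
      exact ⟨s e, h1, h2, (hwind hsb e (fun h => h6 (hbs e h)) h6 1).2 (hin _ h5)⟩

/-- The vertices between two merge loops are closed under going backward, those between two split
loops under going forward. Being finite in number and nonempty, they carry a third cycle of
intermediate radius. -/
theorem not_both_isMergeLoop_or_isSplitLoop [Finite E] (hG : G.IsAnnularStrandDiagram)
    (hred : G.IsReduced) {a b : G.DirectedCycle} {q} (ha : a.LiesIn (Sum.inl q : G.Component))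
    (hb : b.LiesIn (Sum.inl q : G.Component)) (hab : a.radius < b.radius)
    (hno : ∀ c : G.DirectedCycle, c.LiesIn (Sum.inl q : G.Component) →
      ¬ (a.radius < c.radius ∧ c.radius < b.radius)) :
    ¬ (a.IsMergeLoop ∧ b.IsMergeLoop) ∧ ¬ (a.IsSplitLoop ∧ b.IsSplitLoop) := by
  have key : ∀ c : G.DirectedCycle, c.edgeSet.Nonempty → ¬ ∀ e ∈ c.edgeSet,
      G.src e ∈ {v | Quot.mk _ v = q ∧ a.HasWinding (G.pos v) 0 ∧ b.HasWinding (G.pos v) 1} := by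
    intro c hc h
    refine hno c (liesIn_of_edgeSet hc fun e he => by rw [(h e he).1]) ?_
    obtain ⟨e, he⟩ := hc
    have hmem : G.pos (G.src e) ∈ c.trace := pos_mem_trace_iff.2 ⟨e, he, rfl⟩
    exact ⟨radius_lt_of_hasWinding_zero hG hred hmem (h e he).2.1,
      radius_lt_of_hasWinding_one hG hred hmem (h e he).2.2⟩
  refine ⟨fun h => ?_, fun h => ?_⟩
  · obtain ⟨hR, v, hv⟩ := between_closed hG hred ha hb hab (Or.inl ⟨rfl, rfl⟩)
      (fun _ => h.1.tgt_mem) (fun _ => h.2.tgt_mem) rfl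
    obtain ⟨c, hc, hcR⟩ := exists_cycle_of_backward hG hR hv
    exact key c hc hcR
  · obtain ⟨hR, v, hv⟩ := between_closed hG hred ha hb hab (Or.inr ⟨rfl, rfl⟩)
      (fun _ => h.1.src_mem) (fun _ => h.2.src_mem) rfl
    obtain ⟨c, hc, hcR⟩ := exists_cycle_of_forward hG hR hv
    exact key c hc hcR

theorem exists_liesIn [Finite E] (hG : G.IsAnnularStrandDiagram) (K : G.Component) :
    ∃ a : G.DirectedCycle, a.LiesIn K := by
  rcases K with q | l
  · obtain ⟨v, rfl⟩ := Quot.exists_rep q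
    obtain ⟨a, ha, haR⟩ := exists_cycle_of_forward hG (v := v)
      (R := {u | (Quot.mk _ u : Quot fun u v : V => ∃ e, G.src e = u ∧ G.tgt e = v) = Quot.mk _ v})
      (fun e he => (Quot.sound ⟨e, rfl, rfl⟩ : Quot.mk _ (G.src e) = _).symm.trans he) rfl
    exact ⟨a, liesIn_of_edgeSet ha fun e he => congrArg Sum.inl (haR e he)⟩
  · exact ⟨free l, rfl⟩

/-- Edge counting supplies both a merge and a split. The merges of the component are closed forward
and its splits backward, so each kind carries a cycle of its own. -/
theorem exists_ne_liesIn [Finite V] [Finite E] (hG : G.IsAnnularStrandDiagram)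
    (hred : G.IsReduced) (q : Quot fun u v : V => ∃ e, G.src e = u ∧ G.tgt e = v) :
    ∃ a b : G.DirectedCycle, a ≠ b ∧ a.LiesIn (Sum.inl q) ∧ b.LiesIn (Sum.inl q) := by
  have hsound : ∀ e, (Quot.mk _ (G.src e) : Quot fun u v : V => ∃ e, G.src e = u ∧ G.tgt e = v) =
      Quot.mk _ (G.tgt e) := fun e => Quot.sound ⟨e, rfl, rfl⟩
  obtain ⟨v, hv⟩ := Quot.exists_rep q
  have hm : ∃ u, Quot.mk _ u = q ∧ G.IsMerge u := by
    by_contra! h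
    have hs : ∀ u, Quot.mk _ u = q → G.IsSplit u := fun u hu =>
      (hG.split_or_merge u).resolve_right (h u hu)
    have := eq_empty_of_outdegree_one_of_indegree_two (src := G.tgt) (tgt := G.src)
      (K := {u | Quot.mk _ u = q}) (fun e => by simp only [mem_ofPred_eq, hsound])
      (fun u hu => (hs u hu).1) (fun u hu => (hs u hu).2)
    exact this.subset hv
  have hs : ∃ u, Quot.mk _ u = q ∧ G.IsSplit u := by
    by_contra! h
    have hs : ∀ u, Quot.mk _ u = q → G.IsMerge u := fun u hu =>
      (hG.split_or_merge u).resolve_left (h u hu)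
    have := eq_empty_of_outdegree_one_of_indegree_two (src := G.src) (tgt := G.tgt)
      (K := {u | Quot.mk _ u = q}) (fun e => by simp only [mem_ofPred_eq, hsound])
      (fun u hu => (hs u hu).2) (fun u hu => (hs u hu).1)
    exact this.subset hv
  obtain ⟨u, hu⟩ := hm
  obtain ⟨u', hu'⟩ := hs
  obtain ⟨a, ha, haR⟩ := exists_cycle_of_forward hG (R := {u | Quot.mk _ u = q ∧ G.IsMerge u})
    (fun e he => ⟨(hsound e).symm.trans he.1, hG.isMerge_tgt hred he.2⟩) hu
  obtain ⟨b, hb, hbR⟩ := exists_cycle_of_backward hG (R := {u | Quot.mk _ u = q ∧ G.IsSplit u})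
    (fun e he => ⟨(hsound e).trans he.1, hG.isSplit_src hred he.2⟩) hu'
  refine ⟨a, b, ?_, liesIn_of_edgeSet ha fun e he => congrArg Sum.inl (haR e he).1,
    liesIn_of_edgeSet hb fun e he => congrArg Sum.inl (hbR e he).1⟩
  rintro rfl
  obtain ⟨e, he⟩ := ha
  exact (hbR e he).2.not_isMerge (haR e he).2

theorem exists_list [Finite E] [Finite L] (hG : G.IsAnnularStrandDiagram) (hred : G.IsReduced)
    (K : G.Component) : ∃ C : List G.DirectedCycle,
      C.Nodup ∧ (∀ a, a ∈ C ↔ a.LiesIn K) ∧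
      C.Pairwise (fun a b => a.Inside b) ∧
      (∀ σ, G.IsCuttingPath σ → C.Pairwise fun a b =>
        ∀ s ∈ Set.Icc (0 : ℝ) 1, ∀ t ∈ Set.Icc (0 : ℝ) 1, σ s ∈ a.trace → σ t ∈ b.trace → s < t) ∧
      C.IsChain (fun a b =>
        (a.IsMergeLoop ∧ b.IsSplitLoop) ∨ (a.IsSplitLoop ∧ b.IsMergeLoop)) := by
  have := finite hG hred
  obtain ⟨C, hmem, hC⟩ := exists_list_pairwise_lt (radius_injective hG hred) fun a => a.LiesIn K
  have hin : ∀ {a b : G.DirectedCycle}, a.radius < b.radius → a.Inside b := fun {a b} hab =>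
    (inside_of_radius_le hG hred (fun h => (h ▸ hab).ne rfl) hab.le).1
  refine ⟨C, hC.imp fun hab h => (h ▸ hab).ne rfl, hmem, hC.imp hin, fun σ hσ =>
    hC.imp fun hab s hs t ht => (hin hab).lt_of_meet hG (isSimple hG hred _) hσ hs ht,
    hC.isChain_of_forall_adjacent fun a ha b hb hab hno => ?_⟩
  rw [hmem] at ha hb
  rcases K with q | l
  · obtain ⟨h1, h2⟩ := not_both_isMergeLoop_or_isSplitLoop hG hred ha hb hab
      fun c hc => hno c ((hmem c).2 hc)
    have h3 := isMergeLoop_or_isSplitLoop hG hred (edgeSet_nonempty_of_liesIn ha)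
    have h4 := isMergeLoop_or_isSplitLoop hG hred (edgeSet_nonempty_of_liesIn hb)
    tauto
  -- The component of a free loop contains only that cycle, so no two neighbours exist.
  · have key : ∀ c : G.DirectedCycle, c.LiesIn (Sum.inr l) → c = free l := fun c hc => by
      rcases c.edgeSet_nonempty_or with ⟨e, he⟩ | ⟨m, rfl⟩
      · cases (liesIn_iff.1 hc).1 e he
      · rw [Sum.inr.inj ((liesIn_iff.1 hc).2 m rfl)]
    rw [key a ha, key b hb] at hab
    exact absurd hab (lt_irrefl _)

end DirectedCycle

end AnnularGraph

theorem mainTheorem7 {V E L : Type*} [Finite V] [Finite E] [Finite L]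
    (G : AnnularGraph V E L) (hG : G.IsAnnularStrandDiagram) (hred : G.IsReduced) :
    -- directed cycles are pairwise disjoint and simple
    ((∀ a b : G.DirectedCycle, a ≠ b → Disjoint a.trace b.trace) ∧
      ∀ a : G.DirectedCycle, a.IsSimple) ∧
    -- each winds exactly once around the hole and meets each cutting path exactly once
    ((∀ a : G.DirectedCycle, a.HasWinding 0 1) ∧
      ∀ σ, G.IsCuttingPath σ → ∀ a : G.DirectedCycle, ∃! t, t ∈ Set.Icc (0 : ℝ) 1 ∧ σ t ∈ a.trace) ∧
    -- every component contains a directed cycle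
    (∀ K : G.Component, ∃ a : G.DirectedCycle, a.LiesIn K) ∧
    -- a component with only one directed cycle is a free loop
    (∀ K : G.Component, (∃! a : G.DirectedCycle, a.LiesIn K) → ∃ l, K = Sum.inr l) ∧
    -- the order of the cycles in a component
    (∀ K : G.Component, ∃ C : List G.DirectedCycle,
      C.Nodup ∧ (∀ a, a ∈ C ↔ a.LiesIn K) ∧
      C.Pairwise (fun a b => a.Inside b) ∧
      (∀ σ, G.IsCuttingPath σ → C.Pairwise fun a b =>
        ∀ s ∈ Set.Icc (0 : ℝ) 1, ∀ t ∈ Set.Icc (0 : ℝ) 1, σ s ∈ a.trace → σ t ∈ b.trace → s < t) ∧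
      C.IsChain (fun a b =>
        (a.IsMergeLoop ∧ b.IsSplitLoop) ∨ (a.IsSplitLoop ∧ b.IsMergeLoop))) := by
  refine ⟨⟨fun a b => AnnularGraph.DirectedCycle.disjoint_trace hG hred,
    AnnularGraph.DirectedCycle.isSimple hG hred⟩,
    ⟨fun a => AnnularGraph.DirectedCycle.hasWinding_zero_one hG (AnnularGraph.DirectedCycle.isSimple hG hred a),
      fun σ hσ a => AnnularGraph.DirectedCycle.existsUnique_meet hG (AnnularGraph.DirectedCycle.isSimple hG hred a) hσ⟩,
    AnnularGraph.DirectedCycle.exists_liesIn hG, ?_,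
    AnnularGraph.DirectedCycle.exists_list hG hred⟩
  rintro (q | l) ⟨c, -, hc⟩
  · obtain ⟨a, b, hab, ha, hb⟩ := AnnularGraph.DirectedCycle.exists_ne_liesIn hG hred q
    exact absurd ((hc a ha).trans (hc b hb).symm) hab
  · exact ⟨l, rfl⟩
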